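/- All hypergraphs are finite, without repeated hyperedges. Let $k\ge 2$. For a $k$-uniform hypergraph $\mathcal H$ on $n$ vertices let $\mathcal A(\mathcal H)$ be its adjacency tensor (of order $k$ and dimension $n$, with entry $a_{i_1\cdots i_k}=\frac1{(k-1)!}$ if $\{i_1,\dots,i_k\}$ is a hyperedge and $0$ otherwise), let $\mathcal D(\mathcal H)$ be the diagonal tensor of vertex degrees, and for $0<\alpha<1$ put $\mathcal A_\alpha(\mathcal H)=\alpha\mathcal D(\mathcal H)+(1-\alpha)\mathcal A(\mathcal H)$. The $d$-th order trace of a tensor $\mathcal T$ of order $k$ and dimension $n$ is $$\mathrm{Tr}_d(\mathcal T)=(k-1)^{n-1}\sum_{d_1+\cdots+d_n=d}\ \prod_{i=1}^n\frac1{(d_i(k-1))!}\Big(\sum_{\beta\in[n]^{k-1}}\mathcal T_{i\beta}\frac{\partial}{\partial a_{i\beta}}\Big)^{d_i}\mathrm{tr}\big(A^{d(k-1)}\big),$$ where $A=(a_{ij})$ is an $n\times n$ matrix of indeterminates, the $d_i$ are nonnegative integers, and $\frac{\partial}{\partial a_{i\beta}}=\frac{\partial}{\partial a_{i i_2}}\cdots\frac{\partial}{\partial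 a_{i i_k}}$ for $\beta=i_2\cdots i_k$. For $k$-uniform hypergraphs $\mathcal H_1,\mathcal H_2$ with the same number $n$ of vertices, write $\mathcal H_1\prec_\alpha\mathcal H_2$ ($\mathcal H_1$ comes before $\mathcal H_2$ in $S_\alpha$-order) if there is an integer $d$ with $1\le d\le n(k-1)^{n-1}-1$ such that $\mathrm{Tr}_t(\mathcal A_\alpha(\mathcal H_1))=\mathrm{Tr}_t(\mathcal A_\alpha(\mathcal H_2))$ for $t=0,1,\dots,d-1$ and $\mathrm{Tr}_d(\mathcal A_\alpha(\mathcal H_1))<\mathrm{Tr}_d(\mathcal A_\alpha(\mathcal H_2))$. A hypertree is a connected hypergraph without cycles, where a cycle consists of $q\ge2$ distinct vertices $v_1,\dots,v_q$ and $q$ distinct hyperedges $e_1,\dots,e_q$ with $v_i,v_{i+1}\in e_i$ (indices modulo $q$). The starlike hypertree $S^{(k)}_{n_1,\dots,n_r}$ is obtained from $k$-uniform hyperpaths of lengths $n_1,\dots,n_r$ by identifying one end vertex of each of them to a single common vertex. **Theorem.** Let $k\ge2$, $m\ge3$ and $0<\alpha<1$. Among all $k$-uniform hypertrees with $m$ hyperedges,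 the second last hypertree in $S_\alpha$-order is the starlike hypertree $S^{(k)}_{1,2,1,\dots,1}$ (with $m-1$ hyperpaths, one of length $2$ and the others of length $1$). That is, among these hypertrees there is a last one $L$ (every one of them not isomorphic to $L$ comes strictly before $L$), $S^{(k)}_{1,2,1,\dots,1}$ is a $k$-uniform hypertree with $m$ hyperedges not isomorphic to $L$, and $T\prec_\alpha S^{(k)}_{1,2,1,\dots,1}$ for every $k$-uniform hypertree $T$ with $m$ hyperedges that is isomorphic neither to $L$ nor to $S^{(k)}_{1,2,1,\dots,1}$. -/

import Mathlib

/-! ### Tensors and their traces -/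

/-- Tensors of order `k` over `R` with index set `V`; the entry `a_{i i₂ ⋯ iₖ}` is written
`A i α` with `α = (i₂, …, iₖ)`. -/
abbrev KTensor (R V : Type*) (k : ℕ) : Type _ := V → (Fin (k - 1) → V) → R

namespace KTensor

variable {R V : Type*} [Field R] {k : ℕ}

/-- The differential operator `∂/∂a_{iα} = ∂/∂a_{i i₂} ⋯ ∂/∂a_{i iₖ}` on polynomials in the
entries `a_{ij}` of an auxiliary matrix. -/
noncomputable def partialOp (R : Type*) {V : Type*} [Field R] {k : ℕ} (i : V)
    (α : Fin (k - 1) → V) : Module.End R (MvPolynomial (V × V) R) :=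
  (List.ofFn fun j => (MvPolynomial.pderiv (R := R) (i, α j)).toLinearMap).prod

/-- The differential operator `∑_α A_{iα} ∂/∂a_{iα}`. -/
noncomputable def rowOp [Fintype V] (A : KTensor R V k) (i : V) :
    Module.End R (MvPolynomial (V × V) R) :=
  ∑ α : Fin (k - 1) → V, A i α • partialOp R i α

theorem pderiv_commute (p q : V × V) :
    Commute ((MvPolynomial.pderiv (R := R) p).toLinearMap : Module.End R (MvPolynomial (V × V) R))
      (MvPolynomial.pderiv (R := R) q).toLinearMap := by
  have h : ⁅MvPolynomial.pderiv (R := R) p, MvPolynomial.pderiv (R := R) q⁆ = 0 := by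
    classical
    apply MvPolynomial.derivation_ext
    intro r
    simp only [Derivation.commutator_apply, MvPolynomial.pderiv_X, Derivation.coe_zero,
      Pi.zero_apply, Pi.single_apply]
    split_ifs <;> simp
  refine LinearMap.ext fun x => ?_
  have := congrArg (fun D => D x) h
  simp only [Derivation.commutator_apply, Derivation.coe_zero, Pi.zero_apply] at this
  exact sub_eq_zero.mp this

theorem partialOp_commute (i j : V) (α β : Fin (k - 1) → V) :
    Commute (partialOp R i α) (partialOp R j β) := by
  refine Commute.list_prod_right _ _ fun x hx => Commute.list_prod_left _ _ fun y hy => ?_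
  obtain ⟨a, rfl⟩ := List.mem_ofFn.mp hx
  obtain ⟨b, rfl⟩ := List.mem_ofFn.mp hy
  exact pderiv_commute _ _

theorem rowOp_commute [Fintype V] (A : KTensor R V k) (i j : V) :
    Commute (rowOp A i) (rowOp A j) :=
  Commute.sum_right _ _ _ fun _ _ => Commute.sum_left _ _ _ fun _ _ =>
    ((partialOp_commute _ _ _ _).smul_left _).smul_right _

theorem rowOp_pow_pairwise [Fintype V] (A : KTensor R V k) (c : V → ℕ) :
    ((Finset.univ : Finset V) : Set V).Pairwise
      (Function.onFun Commute fun i => rowOp A i ^ c i) :=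
  fun i _ j _ _ => (rowOp_commute A i j).pow_pow (c i) (c j)

/-- The `d`-th order trace of a tensor of order `k` and dimension `n = |V|`:
`(k-1)^{n-1} ∑_{∑ dᵢ = d} ∏ᵢ (1 / (dᵢ(k-1))!) (∑_α A_{iα} ∂/∂a_{iα})^{dᵢ} tr(a^{d(k-1)})`,
where `a = (a_{ij})` is the auxiliary matrix of indeterminates. The polynomial that the operators
produce has degree `0`; its value is read off as its constant coefficient. -/
noncomputable def trace [Fintype V] [DecidableEq V] (A : KTensor R V k) (d : ℕ) : R :=
  ((k - 1 : ℕ) : R) ^ (Fintype.card V - 1) *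
    ∑ c ∈ Finset.piAntidiag (Finset.univ : Finset V) d,
      (∏ i, (1 / ((c i * (k - 1)).factorial : R))) *
        MvPolynomial.constantCoeff
          (Finset.univ.noncommProd (fun i => rowOp A i ^ c i) (rowOp_pow_pairwise A c)
            (Matrix.trace
              ((Matrix.of fun i j : V => (MvPolynomial.X (i, j) : MvPolynomial (V × V) R)) ^
                (d * (k - 1)))))

end KTensor

/-! ### Hypergraphs -/

namespace Hypergraph

variable {V : Type*}

/-- Every hyperedge has exactly `k` vertices. -/
def IsUniform (H : Hypergraph V) (k : ℕ) : Prop := ∀ e ∈ H.edgeSet, e.encard = k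

/-- The number of hyperedges containing `v`. -/
noncomputable def deg (H : Hypergraph V) (v : V) : ℕ := {e | e ∈ H.edgeSet ∧ v ∈ e}.ncard

/-- Nonempty, and any two vertices are joined by a walk. -/
def IsConnected (H : Hypergraph V) : Prop :=
  H.vertexSet.Nonempty ∧
    ∀ u ∈ H.vertexSet, ∀ v ∈ H.vertexSet, Relation.ReflTransGen H.Adj u v

/-- A cycle of length `q` is a closed alternating sequence `v₀, e₀, v₁, e₁, …, e_{q-1}, v₀` of
`q ≥ 2` distinct vertices and `q` distinct hyperedges with `vᵢ, vᵢ₊₁ ∈ eᵢ`, indices modulo `q`. -/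
def IsCycle (H : Hypergraph V) {q : ℕ} (v : Fin q → V) (e : Fin q → Set V) : Prop :=
  2 ≤ q ∧ Function.Injective v ∧ Function.Injective e ∧
    ∀ i, e i ∈ H.edgeSet ∧ v i ∈ e i ∧ v (finRotate q i) ∈ e i

/-- A hypertree is a connected hypergraph without cycles. -/
def IsHypertree (H : Hypergraph V) : Prop :=
  H.IsConnected ∧ ∀ (q : ℕ) (v : Fin q → V) (e : Fin q → Set V), ¬ H.IsCycle v e

open Classical in
/-- The adjacency tensor of a `k`-uniform hypergraph. -/
noncomputable def adjTensor (H : Hypergraph V) (k : ℕ) : KTensor ℝ V k := fun i α =>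
  if insert i (Set.range α) ∈ H.edgeSet then 1 / ((k - 1).factorial : ℝ) else 0

open Classical in
/-- The diagonal tensor of vertex degrees. -/
noncomputable def degTensor (H : Hypergraph V) (k : ℕ) : KTensor ℝ V k := fun i α =>
  if ∀ j, α j = i then (H.deg i : ℝ) else 0

/-- `𝒜_a(H) = a 𝒟(H) + (1 - a) 𝒜(H)`. -/
noncomputable def alphaTensor (H : Hypergraph V) (k : ℕ) (a : ℝ) : KTensor ℝ V k :=
  a • H.degTensor k + (1 - a) • H.adjTensor k

end Hypergraph

/-- A finite hypergraph whose vertices are exactly the elements of the finite type `V`. -/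
structure FinHypergraph where
  V : Type
  [fintypeV : Fintype V]
  [decEqV : DecidableEq V]
  graph : Hypergraph V
  vertexSet_eq : graph.vertexSet = Set.univ

namespace FinHypergraph

attribute [instance] FinHypergraph.fintypeV FinHypergraph.decEqV

/-- The `t`-th order `𝒜_a`-spectral moment `Tr_t(𝒜_a(H))` of a `k`-uniform hypergraph. -/
noncomputable def moment (k : ℕ) (a : ℝ) (H : FinHypergraph) (t : ℕ) : ℝ :=
  (H.graph.alphaTensor k a).trace t

/-- `H₁ ≺_a H₂` in the `S_a`-order of `k`-uniform hypergraphs with the same number `n` of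
vertices: lexicographic comparison of the moments of orders `0, 1, …, n(k-1)^{n-1} - 1`. -/
def SPrec (k : ℕ) (a : ℝ) (H₁ H₂ : FinHypergraph) : Prop :=
  Fintype.card H₁.V = Fintype.card H₂.V ∧
    ∃ d : ℕ, 1 ≤ d ∧ d ≤ Fintype.card H₁.V * (k - 1) ^ (Fintype.card H₁.V - 1) - 1 ∧
      (∀ t < d, moment k a H₁ t = moment k a H₂ t) ∧ moment k a H₁ d < moment k a H₂ d

/-- Isomorphism of hypergraphs. -/
def Iso (H₁ H₂ : FinHypergraph) : Prop :=
  ∃ σ : H₁.V ≃ H₂.V, H₁.graph.image σ = H₂.graph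

/-- `H` is, up to isomorphism, the last member of the class `P` in the `S_a`-order: every
other member comes strictly before it. -/
def IsLast (k : ℕ) (a : ℝ) (P : FinHypergraph → Prop) (H : FinHypergraph) : Prop :=
  P H ∧ ∀ T, P T → ¬ Iso T H → SPrec k a T H

/-- `H` is, up to isomorphism, the second last member of the class `P`: the class has a last
member `L`, and `H` is the last among the members not isomorphic to `L`. -/
def IsSecondLast (k : ℕ) (a : ℝ) (P : FinHypergraph → Prop) (H : FinHypergraph) : Prop :=
  ∃ L, IsLast k a P L ∧ IsLast k a (fun T => P T ∧ ¬ Iso T L) H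

/-- The `k`-uniform hypertrees with `m` hyperedges. -/
def IsUniformHypertree (k m : ℕ) (T : FinHypergraph) : Prop :=
  T.graph.IsUniform k ∧ T.graph.IsHypertree ∧ T.graph.edgeSet.ncard = m

/-- The vertex set of a starlike hypertree with `r` legs of lengths `ℓ 0, …, ℓ (r - 1)`: the
common vertex `none`, and the further vertices of the legs. -/
abbrev StarlikeVertex (k : ℕ) {r : ℕ} (ℓ : Fin r → ℕ) : Type :=
  Option (Σ i : Fin r, Fin (ℓ i * (k - 1)))

/-- `AtPosition i p x` says that `x` is the `p`-th vertex along leg `i`, counted from the common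
vertex, which is at position `0` on every leg. -/
def AtPosition {k r : ℕ} {ℓ : Fin r → ℕ} (i : Fin r) (p : ℕ) : StarlikeVertex k ℓ → Prop
  | none => p = 0
  | some y => y.1 = i ∧ p = y.2.val + 1

/-- The starlike hypertree `S^{(k)}_{ℓ 0, …, ℓ (r - 1)}`: hyperpaths of lengths `ℓ 0, …, ℓ (r - 1)`
sharing a common end vertex. The hyperpath of length `ℓ i` has vertices `0, …, (ℓ i)(k-1)`, and its
`j`-th hyperedge consists of the vertices `j(k-1), …, (j+1)(k-1)`, for `j < ℓ i`. -/
def starlike (k : ℕ) {r : ℕ} (ℓ : Fin r → ℕ) : FinHypergraph where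
  V := StarlikeVertex k ℓ
  graph :=
    { vertexSet := Set.univ
      edgeSet := {e | ∃ i : Fin r, ∃ j < ℓ i,
        e = {x | ∃ p, j * (k - 1) ≤ p ∧ p ≤ (j + 1) * (k - 1) ∧ AtPosition i p x}}
      subset_vertexSet_of_mem_edgeSet' := fun _ _ => Set.subset_univ _ }
  vertexSet_eq := rfl

end FinHypergraph

/-! The moments of orders 0, 1 and 2 decide everything. A coefficient of `tr(A^N)` counts closed
walks, so a product of row operators contributes only when the arcs it differentiates form a closed
walk. This makes `Tr_0` and `Tr_1` functions of the number of vertices and the degree sum, and gives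
`Tr_2 = (k-1)^(n-1) (a² ∑ d_v² + [k = 2] (1-a)² ∑ d_v)` (`alphaTensor_trace_two`).

The incidence graph of a hypertree with `m` hyperedges is a tree, hence `∑ d_v = mk` and `n = m(k-1)
+ 1` (`IsHypertree.card`). All these hypertrees therefore agree in `Tr_0` and `Tr_1`, and a larger
`∑ d_v²`, equivalently a larger `∑ (d_v - 1)²`, comes later in the order (`sPrec_of_sum_sq_lt`).

The excesses `d_v - 1` are nonnegative with sum `m - 1`, so one large degree forces a large sum of
squares. A vertex of degree `m` forces the star, and one of degree `m - 1` forces the starlike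
hypertree with legs `1, 2, 1, …, 1` (`iso_starlike_of_deg_eq`, `iso_nearStar_of_deg_add_one_eq`).
Bounding the sum by the maximal excess times `m - 1` puts every other hypertree strictly below these
two. -/

/-! ### Coefficients of the traces of powers of the generic matrix -/

namespace KTensor

open MvPolynomial

section GenericMatrix

variable {V : Type*} (R : Type*) [Field R] [Fintype V] [DecidableEq V]

/-- The matrix of indeterminates. -/
noncomputable abbrev genMat : Matrix V V (MvPolynomial (V × V) R) :=
  Matrix.of fun i j : V => (X (i, j) : MvPolynomial (V × V) R)

/-- The coefficient counts walks from `i` to `j` that use each arc as often as `m` prescribes; the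
recursion removes the last arc. -/
theorem coeff_genMat_pow_succ (m : V × V →₀ ℕ) (N : ℕ) (i j : V) :
    coeff m ((genMat R ^ (N + 1) : Matrix V V (MvPolynomial (V × V) R)) i j) =
      ∑ l, if m (l, j) ≠ 0 then
        coeff (m - Finsupp.single (l, j) 1) ((genMat R ^ N : Matrix V V _) i l) else 0 := by
  rw [pow_succ, Matrix.mul_apply, coeff_sum]
  refine Finset.sum_congr rfl fun l _ => ?_
  change coeff m (_ * X (l, j)) = _
  rw [coeff_mul_X']
  simp only [Finsupp.mem_support_iff]

/-- Walks from `i` to `j` leave each vertex as often as they enter it, up to the end points. -/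
theorem balanced_of_coeff_genMat_pow_ne_zero (N : ℕ) (i j : V) (m : V × V →₀ ℕ)
    (h : coeff m ((genMat R ^ N : Matrix V V (MvPolynomial (V × V) R)) i j) ≠ 0) (v : V) :
    ∑ u, m (u, v) + (if i = v then 1 else 0) = ∑ u, m (v, u) + (if j = v then 1 else 0) := by
  induction N generalizing j m with
  | zero =>
    rw [pow_zero, Matrix.one_apply] at h
    split_ifs at h with hij
    · subst hij
      rw [coeff_one] at h
      have : m = 0 := by
        by_contra h0
        exact h (if_neg fun h1 => h0 h1.symm)
      simp [this]
    · simp at h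
  | succ N ih =>
    rw [coeff_genMat_pow_succ] at h
    obtain ⟨l, -, hl⟩ := Finset.exists_ne_zero_of_sum_ne_zero h
    split_ifs at hl with hm
    · have hb := ih l _ hl
      obtain ⟨m', rfl⟩ : ∃ m', m = m' + Finsupp.single (l, j) 1 :=
        ⟨m - Finsupp.single (l, j) 1, (tsub_add_cancel_of_le (by
          rw [Finsupp.single_le_iff]; omega)).symm⟩
      rw [add_tsub_cancel_right] at hb
      have e1 : ∑ u, (m' + Finsupp.single (l, j) 1 : V × V →₀ ℕ) (u, v) =
          ∑ u, m' (u, v) + (if j = v then 1 else 0) := by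
        simp only [Finsupp.add_apply, Finset.sum_add_distrib, Finsupp.single_apply, Prod.mk.injEq]
        congr 1
        by_cases hj : j = v <;> simp [hj]
      have e2 : ∑ u, (m' + Finsupp.single (l, j) 1 : V × V →₀ ℕ) (v, u) =
          ∑ u, m' (v, u) + (if l = v then 1 else 0) := by
        simp only [Finsupp.add_apply, Finset.sum_add_distrib, Finsupp.single_apply, Prod.mk.injEq]
        congr 1
        by_cases hj : l = v <;> simp [hj]
      rw [e1, e2]
      omega
    · exact absurd rfl hl

/-- A walk made of loops never leaves its starting vertex, so there is exactly one of each length.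
-/
theorem coeff_genMat_pow_of_diag (N : ℕ) (i j : V) (m : V × V →₀ ℕ)
    (hm : ∀ p, m p ≠ 0 → p.1 = p.2) :
    coeff m ((genMat R ^ N : Matrix V V (MvPolynomial (V × V) R)) i j) =
      if i = j ∧ m = Finsupp.single (i, i) N then 1 else 0 := by
  induction N generalizing j m with
  | zero =>
    rw [pow_zero, Matrix.one_apply]
    by_cases hij : i = j
    · simp [hij, coeff_one, eq_comm]
    · simp [hij]
  | succ N ih =>
    rw [coeff_genMat_pow_succ, Finset.sum_eq_single j]
    · by_cases h0 : m (j, j) = 0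
      · rw [if_neg (by simpa using h0), if_neg]
        rintro ⟨rfl, rfl⟩
        simp at h0
      · rw [if_pos h0, ih j _ fun p hp => hm p fun h1 => hp (by simp [h1])]
        refine if_congr (and_congr_right ?_) rfl rfl
        rintro rfl
        rw [tsub_eq_iff_eq_add_of_le (by rw [Finsupp.single_le_iff]; omega),
          ← Finsupp.single_add]
    · intro l _ hl
      rw [if_neg]
      intro h
      exact hl (hm _ h)
    · simp

/-- A closed walk that enters `v` must also leave it. -/
theorem coeff_trace_genMat_pow_eq_zero (N : ℕ) (m : V × V →₀ ℕ) (u v : V) (huv : m (u, v) ≠ 0)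
    (hv : ∀ w, m (v, w) = 0) :
    coeff m (Matrix.trace (genMat R ^ N : Matrix V V (MvPolynomial (V × V) R))) = 0 := by
  by_contra h
  rw [Matrix.trace, coeff_sum] at h
  obtain ⟨i, -, hi⟩ := Finset.exists_ne_zero_of_sum_ne_zero h
  have hb := balanced_of_coeff_genMat_pow_ne_zero R N i i m hi v
  have : m (u, v) ≤ ∑ x, m (x, v) :=
    Finset.single_le_sum (f := fun x => m (x, v)) (fun _ _ => Nat.zero_le _) (Finset.mem_univ u)
  simp only [hv, Finset.sum_const_zero] at hb
  omega

theorem coeff_trace_genMat_pow_of_diag (N : ℕ) (m : V × V →₀ ℕ) (hm : ∀ p, m p ≠ 0 → p.1 = p.2) :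
    coeff m (Matrix.trace (genMat R ^ N : Matrix V V (MvPolynomial (V × V) R))) =
      ∑ i, if m = Finsupp.single (i, i) N then 1 else 0 := by
  rw [Matrix.trace, coeff_sum]
  refine Finset.sum_congr rfl fun i _ => ?_
  rw [Matrix.diag_apply, coeff_genMat_pow_of_diag R N i i m hm]
  simp

end GenericMatrix

/-! ### Iterated partial derivatives -/

section Derivatives

variable {σ R : Type*} [Field R]

/-- The differential operator `∂/∂x_{p₁} ⋯ ∂/∂x_{pᵣ}` for a list `p₁, …, pᵣ` of variables. -/
noncomputable def listOp (l : List σ) : Module.End R (MvPolynomial σ R) :=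
  (l.map fun p => (pderiv (R := R) p).toLinearMap).prod

theorem listOp_append (l₁ l₂ : List σ) :
    (listOp (l₁ ++ l₂) : Module.End R (MvPolynomial σ R)) = listOp l₁ * listOp l₂ := by
  simp [listOp]

theorem listOp_cons_apply (p : σ) (l : List σ) (P : MvPolynomial σ R) :
    listOp (p :: l) P = pderiv p (listOp l P) := by
  simp [listOp, Module.End.mul_apply]

theorem sum_single_apply_eq_zero (l : List σ) (p : σ) :
    (l.map fun q => Finsupp.single q 1).sum p = 0 ↔ p ∉ l := by
  classical
  induction l with
  | nil => simp
  | cons q l ih =>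
    rw [List.map_cons, List.sum_cons, Finsupp.add_apply, Nat.add_eq_zero_iff, ih,
      Finsupp.single_apply]
    simp [eq_comm (a := p)]

/-- Differentiating shifts exponents and multiplies by a scalar. The scalar is left unspecified
because this form only serves to transfer vanishing. -/
theorem exists_coeff_listOp (l : List σ) (P : MvPolynomial σ R) (m : σ →₀ ℕ) :
    ∃ w : R, coeff m (listOp l P) =
      w * coeff (m + (l.map fun q => Finsupp.single q 1).sum) P := by
  induction l generalizing m with
  | nil => exact ⟨1, by simp [listOp]⟩
  | cons p l ih =>
    obtain ⟨w, hw⟩ := ih (m + Finsupp.single p 1)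
    refine ⟨(m p + 1) * w, ?_⟩
    rw [listOp_cons_apply, coeff_pderiv, hw, List.map_cons, List.sum_cons, add_assoc]
    ring

theorem constantCoeff_listOp_eq_zero (l : List σ) (P : MvPolynomial σ R)
    (h : coeff (l.map fun q => Finsupp.single q 1).sum P = 0) :
    constantCoeff (listOp l P) = 0 := by
  obtain ⟨w, hw⟩ := exists_coeff_listOp l P 0
  rw [constantCoeff_eq, hw, zero_add, h, mul_zero]

theorem coeff_listOp_replicate (p : σ) (r N : ℕ) (P : MvPolynomial σ R) :
    coeff (Finsupp.single p r) (listOp (List.replicate N p) P) =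
      ((r + 1).ascFactorial N : R) * coeff (Finsupp.single p (r + N)) P := by
  induction N generalizing r with
  | zero => simp [listOp]
  | succ N ih =>
    rw [List.replicate_succ, listOp_cons_apply, coeff_pderiv, ← Finsupp.single_add, ih,
      Finsupp.single_eq_same, Nat.ascFactorial_succ, ← Nat.succ_ascFactorial, add_right_comm r 1 N,
      add_assoc r N 1]
    push_cast
    ring

theorem constantCoeff_listOp_replicate (p : σ) (N : ℕ) (P : MvPolynomial σ R) :
    constantCoeff (listOp (List.replicate N p) P) =
      (N.factorial : R) * coeff (Finsupp.single p N) P := by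
  have := coeff_listOp_replicate p 0 N P
  rwa [Finsupp.single_zero, ← constantCoeff_eq, zero_add, zero_add, Nat.one_ascFactorial] at this

end Derivatives

/-! ### Row operators applied to traces of powers of the generic matrix. -/

section RowOperators

variable {V R : Type*} [Field R] {k : ℕ}

theorem partialOp_eq_listOp (i : V) (α : Fin (k - 1) → V) :
    partialOp R i α = listOp (List.ofFn fun j => (i, α j)) := by
  rw [partialOp, listOp, List.map_ofFn]
  rfl

variable [Fintype V] [DecidableEq V]

theorem constantCoeff_listOp_trace_of_source (l : List (V × V)) (N : ℕ) (u v : V)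
    (huv : (u, v) ∈ l) (hv : ∀ w, (v, w) ∉ l) :
    constantCoeff (listOp l (Matrix.trace (genMat R ^ N : Matrix V V _))) = 0 := by
  refine constantCoeff_listOp_eq_zero _ _ (coeff_trace_genMat_pow_eq_zero R N _ u v ?_ ?_)
  · exact fun h => (sum_single_apply_eq_zero _ _).mp h huv
  · exact fun w => (sum_single_apply_eq_zero _ _).mpr (hv w)

/-- A walk made of loops cannot visit two different vertices. -/
theorem constantCoeff_listOp_trace_of_diag (l : List (V × V)) (N : ℕ) (u v : V)
    (hl : ∀ p ∈ l, p.1 = p.2) (hu : (u, u) ∈ l) (hv : (v, v) ∈ l) (huv : u ≠ v) :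
    constantCoeff (listOp l (Matrix.trace (genMat R ^ N : Matrix V V _))) = 0 := by
  refine constantCoeff_listOp_eq_zero _ _ ?_
  rw [coeff_trace_genMat_pow_of_diag]
  · refine Finset.sum_eq_zero fun i _ => if_neg fun h => huv ?_
    have key : ∀ x, (x, x) ∈ l → i = x := by
      intro x hx
      by_contra hix
      have h1 := DFunLike.congr_fun h (x, x)
      rw [Finsupp.single_apply, if_neg (by simpa using hix)] at h1
      exact (sum_single_apply_eq_zero _ _).mp h1 hx
    rw [← key u hu, ← key v hv]
  · intro p hp
    exact hl p (not_not.mp fun h => hp ((sum_single_apply_eq_zero _ _).mpr h))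

theorem constantCoeff_listOp_replicate_trace (v : V) {N : ℕ} (hN : N ≠ 0) :
    constantCoeff (listOp (List.replicate N (v, v)) (Matrix.trace (genMat R ^ N : Matrix V V _))) =
      (N.factorial : R) := by
  rw [constantCoeff_listOp_replicate, coeff_trace_genMat_pow_of_diag, Finset.sum_eq_single v]
  · simp
  · intro i _ hi
    rw [if_neg]
    intro h
    rw [Finsupp.single_left_inj hN] at h
    exact hi (congrArg Prod.fst h).symm
  · simp
  · intro p hp
    rw [Finsupp.single_apply] at hp
    split_ifs at hp with h
    · rw [← h]
    · exact absurd rfl hp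

omit [DecidableEq V] in
theorem constantCoeff_rowOp (A : KTensor R V k) (i : V) (P : MvPolynomial (V × V) R) :
    constantCoeff (rowOp A i P) = ∑ α, A i α * constantCoeff (partialOp R i α P) := by
  rw [rowOp, LinearMap.sum_apply, map_sum]
  simp

omit [DecidableEq V] in
theorem constantCoeff_rowOp_mul (A : KTensor R V k) (i j : V) (P : MvPolynomial (V × V) R) :
    constantCoeff ((rowOp A i * rowOp A j) P) =
      ∑ α, ∑ β, A i α * A j β * constantCoeff ((partialOp R i α * partialOp R j β) P) := by
  simp only [rowOp, Finset.sum_mul_sum, LinearMap.sum_apply, map_sum, smul_mul_smul_comm,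
    LinearMap.smul_apply, constantCoeff_smul, smul_eq_mul]

/-- All arcs differentiated by row `i` start at `i`. If one ends elsewhere, that end is entered but
never left, so only the constant tuple survives. -/
theorem constantCoeff_rowOp_trace (hk : 2 ≤ k) (A : KTensor R V k) (i : V) :
    constantCoeff (rowOp A i (Matrix.trace (genMat R ^ (k - 1) : Matrix V V _))) =
      ((k - 1).factorial : R) * A i fun _ => i := by
  rw [constantCoeff_rowOp, Finset.sum_eq_single fun _ => i]
  · rw [partialOp_eq_listOp, List.ofFn_const, constantCoeff_listOp_replicate_trace _ (by omega),
      mul_comm]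
  · intro α _ hα
    obtain ⟨l, hl⟩ : ∃ l, α l ≠ i := Function.ne_iff.mp hα
    rw [partialOp_eq_listOp, constantCoeff_listOp_trace_of_source _ _ i (α l), mul_zero]
    · exact List.mem_ofFn.mpr ⟨l, rfl⟩
    · intro w hw
      obtain ⟨_, h⟩ := List.mem_ofFn.mp hw
      exact hl (congrArg Prod.fst h).symm
  · simp

theorem constantCoeff_rowOp_mul_self_trace (hk : 2 ≤ k) (A : KTensor R V k) (i : V) :
    constantCoeff ((rowOp A i * rowOp A i)
        (Matrix.trace (genMat R ^ (2 * (k - 1)) : Matrix V V _))) =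
      ((2 * (k - 1)).factorial : R) * (A i fun _ => i) ^ 2 := by
  have key : ∀ α β : Fin (k - 1) → V, (∃ l, α l ≠ i) ∨ (∃ l, β l ≠ i) →
      constantCoeff ((partialOp R i α * partialOp R i β)
        (Matrix.trace (genMat R ^ (2 * (k - 1)) : Matrix V V _))) = 0 := by
    intro α β h
    obtain ⟨v, hv, hvi⟩ : ∃ v, (i, v) ∈ (List.ofFn fun j => (i, α j)) ++
        List.ofFn (fun j => (i, β j)) ∧ v ≠ i := by
      rcases h with ⟨l, hl⟩ | ⟨l, hl⟩
      · exact ⟨α l, List.mem_append_left _ (List.mem_ofFn.mpr ⟨l, rfl⟩), hl⟩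
      · exact ⟨β l, List.mem_append_right _ (List.mem_ofFn.mpr ⟨l, rfl⟩), hl⟩
    rw [partialOp_eq_listOp, partialOp_eq_listOp, ← listOp_append]
    refine constantCoeff_listOp_trace_of_source _ _ i v hv fun w hw => hvi ?_
    rcases List.mem_append.mp hw with h | h <;>
    · obtain ⟨_, h⟩ := List.mem_ofFn.mp h
      exact (congrArg Prod.fst h).symm
  rw [constantCoeff_rowOp_mul, Finset.sum_eq_single fun _ => i, Finset.sum_eq_single fun _ => i]
  · rw [partialOp_eq_listOp, List.ofFn_const, ← listOp_append, List.replicate_append_replicate,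
      ← two_mul, constantCoeff_listOp_replicate_trace _ (by omega)]
    ring
  · intro β _ hβ
    rw [key _ _ (Or.inr (Function.ne_iff.mp hβ)), mul_zero]
  · simp
  · intro α _ hα
    refine Finset.sum_eq_zero fun β _ => ?_
    rw [key _ _ (Or.inl (Function.ne_iff.mp hα)), mul_zero]
  · simp

/-- Off-diagonal products of row operators do not contribute if the nonzero entries of the tensor
are diagonal or have pairwise distinct indices. -/
theorem constantCoeff_rowOp_mul_trace_eq_zero (hk : 3 ≤ k) (A : KTensor R V k)
    (hA : ∀ i α, A i α ≠ 0 → (∀ j, α j = i) ∨ Function.Injective α ∧ ∀ j, α j ≠ i)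
    {i j : V} (hij : i ≠ j) (N : ℕ) :
    constantCoeff ((rowOp A i * rowOp A j) (Matrix.trace (genMat R ^ N : Matrix V V _))) = 0 := by
  rw [constantCoeff_rowOp_mul]
  refine Finset.sum_eq_zero fun α _ => Finset.sum_eq_zero fun β _ => ?_
  by_cases hα0 : A i α = 0
  · simp [hα0]
  by_cases hβ0 : A j β = 0
  · simp [hβ0]
  -- This is where `3 ≤ k` matters: an injective tuple has at least two entries and so cannot be
  -- constant.
  have hinj : ∀ (γ : Fin (k - 1) → V) (x : V), Function.Injective γ → ∃ l, γ l ≠ x := by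
    intro γ x hγ
    by_contra! h
    have := hγ ((h ⟨0, by omega⟩).trans (h ⟨1, by omega⟩).symm)
    simp at this
  rw [partialOp_eq_listOp, partialOp_eq_listOp, ← listOp_append]
  convert mul_zero (A i α * A j β)
  have hsrc : ∀ v w, (v, w) ∈ (List.ofFn fun l => (i, α l)) ++ List.ofFn (fun l => (j, β l)) →
      v = i ∨ v = j := by
    intro v w h
    rcases List.mem_append.mp h with h | h
    · obtain ⟨_, h⟩ := List.mem_ofFn.mp h
      exact Or.inl (congrArg Prod.fst h).symm
    · obtain ⟨_, h⟩ := List.mem_ofFn.mp h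
      exact Or.inr (congrArg Prod.fst h).symm
  -- Two diagonal entries give loops at distinct vertices. Otherwise some arc ends outside `{i, j}`,
  -- at a vertex that no arc leaves.
  rcases hA i α hα0 with hα | ⟨hα, hαi⟩
  · rcases hA j β hβ0 with hβ | ⟨hβ, hβj⟩
    · refine constantCoeff_listOp_trace_of_diag _ _ i j ?_ ?_ ?_ hij
      · intro p hp
        rcases List.mem_append.mp hp with h | h <;> obtain ⟨l, rfl⟩ := List.mem_ofFn.mp h
        · exact (hα l).symm
        · exact (hβ l).symm
      · exact List.mem_append_left _ (List.mem_ofFn.mpr ⟨⟨0, by omega⟩, by rw [hα]⟩)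
      · exact List.mem_append_right _ (List.mem_ofFn.mpr ⟨⟨0, by omega⟩, by rw [hβ]⟩)
    · obtain ⟨l, hl⟩ := hinj β i hβ
      refine constantCoeff_listOp_trace_of_source _ _ j (β l)
        (List.mem_append_right _ (List.mem_ofFn.mpr ⟨l, rfl⟩)) fun w hw => ?_
      exact (hsrc _ _ hw).elim hl (hβj l)
  · obtain ⟨l, hl⟩ := hinj α j hα
    refine constantCoeff_listOp_trace_of_source _ _ i (α l)
      (List.mem_append_left _ (List.mem_ofFn.mpr ⟨l, rfl⟩)) fun w hw => ?_
    exact (hsrc _ _ hw).elim (hαi l) hl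

end RowOperators

end KTensor

/-! ### Traces of order at most two -/

namespace KTensor

open MvPolynomial

/-! ### Exponent vectors of sum one and two, and products with at most two nontrivial factors. -/

section Auxiliary

variable {V M : Type*} [Fintype V] [DecidableEq V]

theorem sum_piAntidiag_eq_sum_single [AddCommMonoid M] {d : ℕ} (hd : d ≠ 0) (f : (V → ℕ) → M)
    (hf : ∀ c : V → ℕ, ∑ i, c i = d → (∀ i, c ≠ Pi.single i d) → f c = 0) :
    ∑ c ∈ Finset.piAntidiag (Finset.univ : Finset V) d, f c = ∑ i, f (Pi.single i d) := by
  have hinj : Function.Injective fun i : V => (Pi.single i d : V → ℕ) := by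
    intro i j h
    by_contra hij
    have := congrFun h i
    simp [hij, hd] at this
  rw [← Finset.sum_image (g := fun i : V => (Pi.single i d : V → ℕ)) (f := f)
    fun _ _ _ _ h => hinj h]
  symm
  refine Finset.sum_subset ?_ ?_
  · intro c hc
    obtain ⟨i, -, rfl⟩ := Finset.mem_image.mp hc
    simp
  · intro c hc hc'
    refine hf c (by simpa using hc) fun i hi => hc' ?_
    exact Finset.mem_image.mpr ⟨i, Finset.mem_univ _, hi.symm⟩

theorem noncommProd_univ_of_eq_one [Monoid M] (f : V → M) (comm) (a : V)
    (hf : ∀ i, i ≠ a → f i = 1) : (Finset.univ : Finset V).noncommProd f comm = f a := by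
  have h : (Finset.univ.erase a).noncommProd f
      (fun x _ y _ => comm (Finset.mem_coe.mpr (Finset.mem_univ x)) (Finset.mem_univ y)) = 1 :=
    (Finset.noncommProd_eq_pow_card _ f _ 1 fun x hx => hf x (Finset.ne_of_mem_erase hx)).trans
      (one_pow _)
  refine (Finset.mul_noncommProd_erase _ (Finset.mem_univ a) f comm).symm.trans ?_
  exact (congrArg (f a * ·) h).trans (mul_one _)

theorem noncommProd_univ_of_eq_one₂ [Monoid M] (f : V → M) (comm) {a b : V} (hab : a ≠ b)
    (hf : ∀ i, i ≠ a → i ≠ b → f i = 1) :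
    (Finset.univ : Finset V).noncommProd f comm = f a * f b := by
  have comm' : ((Finset.univ.erase a : Finset V) : Set V).Pairwise (Function.onFun Commute f) :=
    fun x _ y _ => comm (Finset.mem_coe.mpr (Finset.mem_univ x)) (Finset.mem_univ y)
  have h : ((Finset.univ.erase a).erase b).noncommProd f (fun x hx y hy => comm'
      (Finset.mem_of_mem_erase hx) (Finset.mem_of_mem_erase hy)) = 1 :=
    (Finset.noncommProd_eq_pow_card _ f _ 1 fun x hx => hf x (Finset.ne_of_mem_erase
      (Finset.mem_of_mem_erase hx)) (Finset.ne_of_mem_erase hx)).trans (one_pow _)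
  refine (Finset.mul_noncommProd_erase _ (Finset.mem_univ a) f comm).symm.trans
    (congrArg (f a * ·) ?_)
  refine (Finset.mul_noncommProd_erase _ (Finset.mem_erase.mpr ⟨hab.symm, Finset.mem_univ b⟩)
    f comm').symm.trans ?_
  exact (congrArg (f b * ·) h).trans (mul_one _)

theorem exists_single_add_single (c : V → ℕ) (hc : ∑ i, c i = 2)
    (h : ∀ i, c ≠ Pi.single i 2) :
    ∃ a b, a ≠ b ∧ c = Pi.single a 1 + Pi.single b 1 := by
  have hsplit : ∀ (c : V → ℕ) (d : ℕ), ∑ i, c i = d + 1 →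
      ∃ (a : V) (c' : V → ℕ), c = Pi.single a 1 + c' ∧ ∑ i, c' i = d := by
    intro c d hc
    obtain ⟨a, -, ha⟩ := Finset.exists_ne_zero_of_sum_ne_zero (by omega : ∑ i, c i ≠ 0)
    have e : c = Pi.single a 1 + (c - Pi.single a 1) := by
      refine (add_tsub_cancel_of_le ?_).symm
      intro i
      by_cases hi : i = a
      · subst hi
        simp only [Pi.single_eq_same]
        omega
      · simp [hi]
    refine ⟨a, c - Pi.single a 1, e, ?_⟩
    rw [e] at hc
    simp only [Pi.add_apply, Finset.sum_add_distrib, Finset.sum_pi_single', Finset.mem_univ,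
      if_true] at hc
    omega
  obtain ⟨a, c', rfl, hc'⟩ := hsplit c 1 hc
  obtain ⟨b, c'', rfl, hc''⟩ := hsplit c' 0 hc'
  have h0 : c'' = 0 := funext fun i => by
    simpa using (Finset.sum_eq_zero_iff.mp hc'') i (Finset.mem_univ i)
  subst h0
  refine ⟨a, b, ?_, by simp⟩
  rintro rfl
  refine h a ?_
  rw [add_zero, ← Pi.single_add]

end Auxiliary

variable {V R : Type*} [Field R] [Fintype V] [DecidableEq V] {k : ℕ}

theorem noncommProd_rowOp_single (A : KTensor R V k) (a : V) (d : ℕ) :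
    Finset.univ.noncommProd (fun i => rowOp A i ^ (Pi.single a d : V → ℕ) i)
      (rowOp_pow_pairwise A _) = rowOp A a ^ d := by
  rw [noncommProd_univ_of_eq_one _ _ a fun i hi => by rw [Pi.single_eq_of_ne hi, pow_zero],
    Pi.single_eq_same]

theorem noncommProd_rowOp_single_add (A : KTensor R V k) {a b : V} (hab : a ≠ b) :
    Finset.univ.noncommProd
      (fun i => rowOp A i ^ (Pi.single a 1 + Pi.single b 1 : V → ℕ) i)
      (rowOp_pow_pairwise A _) = rowOp A a * rowOp A b := by
  rw [noncommProd_univ_of_eq_one₂ _ _ hab fun i hi hi' => by simp [hi, hi']]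
  simp [hab, hab.symm]

theorem prod_one_div_factorial_single (a : V) (d r : ℕ) :
    ∏ i, (1 / ((((Pi.single a d : V → ℕ) i) * r).factorial : R)) = 1 / ((d * r).factorial : R) := by
  rw [Finset.prod_eq_single a]
  · simp
  · intro b _ hb
    simp [hb]
  · simp

theorem trace_zero (A : KTensor R V k) :
    A.trace 0 = ((k - 1 : ℕ) : R) ^ (Fintype.card V - 1) * Fintype.card V := by
  have h : (Finset.univ : Finset V).noncommProd (fun i => rowOp A i ^ (0 : V → ℕ) i)
      (rowOp_pow_pairwise A _) = 1 := by
    rw [Finset.noncommProd_eq_pow_card _ _ _ 1]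
    · simp
    · simp
  rw [trace, Finset.piAntidiag_zero, Finset.sum_singleton, h]
  simp [Matrix.trace_one]

variable [CharZero R]

/-- The exponent vectors of sum 1 are the unit vectors, and `(k-1)!` cancels the normalising factor.
-/
theorem trace_one (hk : 2 ≤ k) (A : KTensor R V k) :
    A.trace 1 = ((k - 1 : ℕ) : R) ^ (Fintype.card V - 1) * ∑ i, A i fun _ => i := by
  rw [trace, sum_piAntidiag_eq_sum_single one_ne_zero]
  · congr 1
    refine Finset.sum_congr rfl fun i _ => ?_
    rw [noncommProd_rowOp_single, pow_one, one_mul, constantCoeff_rowOp_trace hk,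
      prod_one_div_factorial_single, one_mul, ← mul_assoc,
      one_div_mul_cancel (Nat.cast_ne_zero.mpr (Nat.factorial_ne_zero _)), one_mul]
  · intro c hc h
    exfalso
    obtain ⟨a, -, ha⟩ := Finset.exists_ne_zero_of_sum_ne_zero (by omega : ∑ i, c i ≠ 0)
    refine h a (funext fun i => ?_)
    have hsum := Finset.add_sum_erase _ c (Finset.mem_univ a)
    have h0 : ∑ i ∈ Finset.univ.erase a, c i = 0 := by omega
    by_cases hi : i = a
    · subst hi
      rw [Pi.single_eq_same]
      omega
    · rw [Pi.single_eq_of_ne hi]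
      exact Finset.sum_eq_zero_iff.mp h0 i (Finset.mem_erase.mpr ⟨hi, Finset.mem_univ _⟩)

theorem trace_two_of_three_le (hk : 3 ≤ k) (A : KTensor R V k)
    (hA : ∀ i α, A i α ≠ 0 → (∀ j, α j = i) ∨ Function.Injective α ∧ ∀ j, α j ≠ i) :
    A.trace 2 = ((k - 1 : ℕ) : R) ^ (Fintype.card V - 1) * ∑ i, (A i fun _ => i) ^ 2 := by
  rw [trace, sum_piAntidiag_eq_sum_single two_ne_zero]
  · congr 1
    refine Finset.sum_congr rfl fun i _ => ?_
    rw [noncommProd_rowOp_single, pow_two, constantCoeff_rowOp_mul_self_trace (by omega),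
      prod_one_div_factorial_single, ← mul_assoc,
      one_div_mul_cancel (Nat.cast_ne_zero.mpr (Nat.factorial_ne_zero _)), one_mul]
  · intro c hc h
    obtain ⟨a, b, hab, rfl⟩ := exists_single_add_single c hc h
    rw [noncommProd_rowOp_single_add A hab, constantCoeff_rowOp_mul_trace_eq_zero hk A hA hab,
      mul_zero]

-- For `k = 2` each row operator differentiates a single arc, and a closed walk of two arcs goes
-- from `i` to `j` and back. The factor 2 counts its two starting points; for `i = j` it comes from
-- the second derivative of a square.
omit [CharZero R] in
theorem constantCoeff_rowOp_mul_trace_sq (A : KTensor R V 2) (i j : V) :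
    constantCoeff ((rowOp A i * rowOp A j) (Matrix.trace (genMat R ^ 2 : Matrix V V _))) =
      2 * (A i (fun _ => j) * A j fun _ => i) := by
  have key : ∀ u v : V, constantCoeff ((partialOp R (k := 2) i (fun _ => u) *
      partialOp R (k := 2) j fun _ => v) (Matrix.trace (genMat R ^ 2 : Matrix V V _))) =
      if u = j ∧ v = i then 2 else 0 := by
    intro u v
    have h1 : Matrix.trace (genMat R ^ 2 : Matrix V V _) =
        ∑ p : V, ∑ q : V, (X (p, q) * X (q, p) : MvPolynomial (V × V) R) := by
      rw [pow_two, Matrix.trace]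
      rfl
    have h2 : ∀ (i u : V), (partialOp R (k := 2) i fun _ => u) =
        (pderiv (R := R) (i, u)).toLinearMap := by
      intro i u
      simp [partialOp]
    rw [h1, h2, h2, Module.End.mul_apply]
    simp only [map_sum, Derivation.coeFn_coe, Derivation.leibniz,
      smul_eq_mul, pderiv_X, map_add,
      map_mul, constantCoeff_X, zero_mul, Finset.sum_add_distrib]
    have h3 : ∀ p q r s : V, constantCoeff
        ((Pi.single (p, q) 1 : V × V → MvPolynomial (V × V) R) (r, s)) =
        (if r = p then 1 else 0) * (if s = q then 1 else 0) := by
      intro p q r s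
      rw [Pi.single_apply]
      by_cases h : r = p <;> by_cases h' : s = q <;> simp [h, h']
    simp only [h3]
    by_cases huj : u = j <;> by_cases hvi : v = i
    · subst huj hvi
      simp [one_add_one_eq_two]
    all_goals simp [huj, hvi, eq_comm (a := i)]
  rw [constantCoeff_rowOp_mul]
  -- Tuples of length `2 - 1` are single vertices.
  have e : ∀ F : (Fin (2 - 1) → V) → R, ∑ α, F α = ∑ u, F fun _ => u := fun F =>
    (Equiv.sum_comp (Equiv.funUnique (Fin 1) V).symm F).symm
  simp only [e, key]
  rw [Finset.sum_eq_single j, Finset.sum_eq_single i]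
  · simp [mul_comm]
  · intro v _ hv
    simp [hv]
  · simp
  · intro u _ hu
    simp [hu]
  · simp

/-- The row operators commute, so the multinomial theorem expands the square of their sum with
weights `2 / ∏ cᵢ!`, twice those in the definition of the trace. -/
theorem trace_two_of_eq_two (A : KTensor R V 2) :
    A.trace 2 = ∑ i, ∑ j, (A i fun _ => j) * A j fun _ => i := by
  have h2 : (2 : R) ≠ 0 := two_ne_zero
  have key : constantCoeff (((∑ i, rowOp A i) ^ 2)
      (Matrix.trace (genMat R ^ 2 : Matrix V V _))) =
      2 * ∑ i, ∑ j, (A i fun _ => j) * A j fun _ => i := by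
    rw [pow_two, Finset.sum_mul_sum, Finset.mul_sum]
    simp only [LinearMap.sum_apply, map_sum, constantCoeff_rowOp_mul_trace_sq, Finset.mul_sum]
  rw [Finset.sum_pow_eq_sum_piAntidiag_of_commute _ _
    fun i _ j _ _ => rowOp_commute A i j] at key
  rw [← mul_right_inj' h2, ← key, trace, LinearMap.sum_apply, map_sum]
  simp only [Nat.add_one_sub_one, Nat.cast_one, one_pow, one_mul, mul_one]
  rw [Finset.mul_sum]
  refine Finset.sum_congr rfl fun c hc => ?_
  have hc' : ∑ i, c i = 2 := by simpa using hc
  rw [Module.End.mul_apply, ← mul_assoc]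
  have h3 : ((Nat.multinomial Finset.univ c : ℕ) : R) = 2 * ∏ i, (1 / ((c i).factorial : R)) := by
    have := Nat.multinomial_spec Finset.univ c
    rw [hc'] at this
    have h4 : (∏ i, ((c i).factorial : R)) * (Nat.multinomial Finset.univ c : R) = 2 := by
      exact_mod_cast congrArg (Nat.cast (R := R)) this
    have h5 : ∏ i, ((c i).factorial : R) ≠ 0 :=
      Finset.prod_ne_zero_iff.mpr fun i _ => Nat.cast_ne_zero.mpr (Nat.factorial_ne_zero _)
    rw [Finset.prod_div_distrib, Finset.prod_const_one, ← h4]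
    field_simp
  rw [← h3, Module.End.natCast_apply, map_nsmul, nsmul_eq_mul]

end KTensor

/-! ### Traces of the tensor `𝒜_a` of a uniform hypergraph -/

namespace Hypergraph

variable {V : Type*} [Fintype V] {k : ℕ} {H : Hypergraph V}

-- The `k` indices fill a set of `k` elements, so no two coincide.
omit [Fintype V] in
theorem injective_of_encard_insert_range {i : V} {α : Fin (k - 1) → V} (hk : 2 ≤ k)
    (h : (insert i (Set.range α)).encard = k) : Function.Injective α ∧ ∀ j, α j ≠ i := by
  have hr : (Set.range α).ncard ≤ k - 1 := by
    have := Set.ncard_image_le (f := α) Set.finite_univ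
    rwa [Set.image_univ, Set.ncard_univ, Nat.card_fin] at this
  have h' : (insert i (Set.range α)).ncard = k := by rw [Set.ncard, h]; rfl
  have hi : i ∉ Set.range α := fun hi => by
    rw [Set.insert_eq_of_mem hi] at h'
    omega
  rw [Set.ncard_insert_of_notMem hi (Set.finite_range α)] at h'
  refine ⟨?_, fun j hj => hi ⟨j, hj⟩⟩
  rw [← Set.injOn_univ]
  refine Set.injOn_of_ncard_image_eq ?_ Set.finite_univ
  rw [Set.image_univ, Set.ncard_univ, Nat.card_fin]
  omega

omit [Fintype V] in
theorem adjTensor_const (hk : 2 ≤ k) (hH : H.IsUniform k) (i : V) :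
    H.adjTensor k i (fun _ => i) = 0 := by
  rw [adjTensor, if_neg]
  intro h
  exact (injective_of_encard_insert_range hk (hH _ h)).2 ⟨0, by omega⟩ rfl

omit [Fintype V] in
theorem alphaTensor_const (hk : 2 ≤ k) (hH : H.IsUniform k) (a : ℝ) (i : V) :
    H.alphaTensor k a i (fun _ => i) = a * H.deg i := by
  simp [alphaTensor, adjTensor_const hk hH, degTensor]

omit [Fintype V] in
theorem alphaTensor_ne_zero (hk : 2 ≤ k) (hH : H.IsUniform k) (a : ℝ) (i : V)
    (α : Fin (k - 1) → V) (h : H.alphaTensor k a i α ≠ 0) :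
    (∀ j, α j = i) ∨ Function.Injective α ∧ ∀ j, α j ≠ i := by
  by_contra! hc
  apply h
  have h1 : ¬ insert i (Set.range α) ∈ H.edgeSet := fun he => by
    obtain ⟨h2, h3⟩ := injective_of_encard_insert_range hk (hH _ he)
    obtain ⟨j, hj⟩ := hc.2 h2
    exact h3 j hj
  have h2 : ¬ ∀ j, α j = i := not_forall.mpr hc.1
  simp [alphaTensor, adjTensor, degTensor, h1, h2]

-- In a graph, `j ↦ {i, j}` is a bijection from the neighbours of `i` to the edges at `i`.
open Classical in
theorem sum_pair_mem_edgeSet (hH : H.IsUniform 2) (i : V) :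
    ∑ j, (if {i, j} ∈ H.edgeSet then (1 : ℝ) else 0) = H.deg i := by
  have h1 : {e | e ∈ H.edgeSet ∧ i ∈ e} = (fun j => ({i, j} : Set V)) ''
      {j | {i, j} ∈ H.edgeSet} := by
    ext e
    constructor
    · rintro ⟨he, hi⟩
      obtain ⟨x, y, hxy, rfl⟩ := Set.encard_eq_two.mp (hH e he)
      rcases hi with rfl | rfl
      · exact ⟨y, he, rfl⟩
      · exact ⟨x, by rwa [Set.mem_ofPred_eq, Set.pair_comm], Set.pair_comm _ _⟩
    · rintro ⟨j, hj, rfl⟩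
      exact ⟨hj, Set.mem_insert _ _⟩
  have h2 : Set.InjOn (fun j => ({i, j} : Set V)) {j | {i, j} ∈ H.edgeSet} := by
    intro x hx y _ hxy
    have hne : x ≠ i := by
      rintro rfl
      have := hH _ hx
      rw [Set.pair_eq_singleton, Set.encard_singleton] at this
      exact absurd this (by decide)
    have : x ∈ ({i, y} : Set V) := by
      simp only [← hxy, Set.mem_insert_iff, Set.mem_singleton_iff, or_true]
    simpa [hne] using this
  rw [deg, h1, h2.ncard_image, Finset.sum_boole, Set.ncard_eq_toFinset_card']
  simp

variable [DecidableEq V]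

theorem alphaTensor_trace_zero (H : Hypergraph V) (a : ℝ) :
    (H.alphaTensor k a).trace 0 =
      ((k - 1 : ℕ) : ℝ) ^ (Fintype.card V - 1) * Fintype.card V :=
  KTensor.trace_zero _

theorem alphaTensor_trace_one (hk : 2 ≤ k) (hH : H.IsUniform k) (a : ℝ) :
    (H.alphaTensor k a).trace 1 =
      ((k - 1 : ℕ) : ℝ) ^ (Fintype.card V - 1) * (a * ∑ i, (H.deg i : ℝ)) := by
  rw [KTensor.trace_one hk]
  simp only [alphaTensor_const hk hH, Finset.mul_sum]

theorem alphaTensor_trace_two (hk : 2 ≤ k) (hH : H.IsUniform k) (a : ℝ) :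
    (H.alphaTensor k a).trace 2 = ((k - 1 : ℕ) : ℝ) ^ (Fintype.card V - 1) *
      (a ^ 2 * ∑ i, (H.deg i : ℝ) ^ 2 +
        if k = 2 then (1 - a) ^ 2 * ∑ i, (H.deg i : ℝ) else 0) := by
  rcases Nat.lt_or_ge 2 k with h3 | h2
  · rw [KTensor.trace_two_of_three_le h3 _ (alphaTensor_ne_zero hk hH a), if_neg (by omega),
      add_zero]
    simp only [alphaTensor_const hk hH, mul_pow, Finset.mul_sum]
  · obtain rfl : k = 2 := le_antisymm h2 hk
    rw [KTensor.trace_two_of_eq_two, if_pos rfl, Finset.mul_sum, Finset.mul_sum,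
      ← Finset.sum_add_distrib]
    simp only [Nat.add_one_sub_one, Nat.cast_one, one_pow, one_mul]
    refine Finset.sum_congr rfl fun i _ => ?_
    classical
    -- The term `j = i` is the square of the diagonal entry `a d_i`. Each remaining term is `(1 -
    -- a)²` or 0, according to whether `{i, j}` is an edge.
    rw [← sum_pair_mem_edgeSet hH i, Finset.mul_sum, ← Finset.add_sum_erase _ _ (Finset.mem_univ i),
      alphaTensor_const le_rfl hH, ← Finset.add_sum_erase (a := i) Finset.univ
        (fun j => (1 - a) ^ 2 * if {i, j} ∈ H.edgeSet then (1 : ℝ) else 0) (Finset.mem_univ i),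
      sum_pair_mem_edgeSet hH i]
    have h0 : ¬ {i, i} ∈ H.edgeSet := fun h => by
      have := hH _ h
      rw [Set.pair_eq_singleton, Set.encard_singleton] at this
      exact absurd this (by decide)
    rw [if_neg h0, mul_zero, zero_add, pow_two (a := a), pow_two (a := (H.deg i : ℝ)),
      mul_mul_mul_comm]
    congr 1
    refine Finset.sum_congr rfl fun j hj => ?_
    have hij : i ≠ j := (Finset.ne_of_mem_erase hj).symm
    have e1 : ∀ x y : V, x ≠ y → H.alphaTensor 2 a x (fun _ => y) =
        (1 - a) * if {x, y} ∈ H.edgeSet then (1 : ℝ) else 0 := by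
      intro x y hxy
      simp [alphaTensor, adjTensor, degTensor, hxy.symm, Set.range_const]
    rw [e1 i j hij, e1 j i hij.symm, Set.pair_comm j i]
    split_ifs <;> ring

end Hypergraph

/-! ### Counting vertices of hypertrees -/

namespace Hypergraph

variable {V : Type*} {k : ℕ} {H : Hypergraph V}

/-- The bipartite incidence graph of vertices and hyperedges. -/
def incidenceGraph (H : Hypergraph V) : SimpleGraph (V ⊕ H.edgeSet) where
  Adj
    | .inl v, .inr e => v ∈ e.1
    | .inr e, .inl v => v ∈ e.1
    | _, _ => False
  symm := ⟨by rintro (v | e) (w | f) h <;> exact h⟩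
  loopless := ⟨by rintro (v | e) h <;> exact h⟩

theorem incidenceGraph_adj_inl_inr {v : V} {e : H.edgeSet} :
    H.incidenceGraph.Adj (.inl v) (.inr e) ↔ v ∈ e.1 := Iff.rfl

theorem incidenceGraph_adj_inr_inl {v : V} {e : H.edgeSet} :
    H.incidenceGraph.Adj (.inr e) (.inl v) ↔ v ∈ e.1 := Iff.rfl

theorem not_incidenceGraph_adj_inl_inl {v w : V} :
    ¬ H.incidenceGraph.Adj (.inl v) (.inl w) := fun h => h

theorem not_incidenceGraph_adj_inr_inr {e f : H.edgeSet} :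
    ¬ H.incidenceGraph.Adj (.inr e) (.inr f) := fun h => h

theorem isLeft_iff_of_incidenceGraph_adj {x y : V ⊕ H.edgeSet} (h : H.incidenceGraph.Adj x y) :
    y.isLeft = !x.isLeft := by
  rcases x with v | e <;> rcases y with w | f
  · exact absurd h not_incidenceGraph_adj_inl_inl
  · rfl
  · rfl
  · exact absurd h not_incidenceGraph_adj_inr_inr

theorem incidenceGraph_connected (hH : H.IsConnected) (hV : H.vertexSet = Set.univ)
    (hne : ∀ e ∈ H.edgeSet, e.Nonempty) : H.incidenceGraph.Connected := by
  have key : ∀ u v : V, H.incidenceGraph.Reachable (.inl u) (.inl v) := by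
    intro u v
    have := hH.2 u (hV ▸ Set.mem_univ u) v (hV ▸ Set.mem_univ v)
    induction this with
    | refl => exact SimpleGraph.Reachable.refl _
    | tail _ hbc ih =>
      obtain ⟨e, he, hb, hc⟩ := hbc
      refine ih.trans (SimpleGraph.Reachable.trans (v := .inr ⟨e, he⟩) ?_ ?_)
      · exact SimpleGraph.Adj.reachable (incidenceGraph_adj_inl_inr.mpr hb)
      · exact SimpleGraph.Adj.reachable (incidenceGraph_adj_inr_inl.mpr hc)
  have key' : ∀ x : V ⊕ H.edgeSet, ∃ v : V, H.incidenceGraph.Reachable x (.inl v) := by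
    rintro (v | ⟨e, he⟩)
    · exact ⟨v, SimpleGraph.Reachable.refl _⟩
    · obtain ⟨v, hv⟩ := hne e he
      exact ⟨v, SimpleGraph.Adj.reachable (incidenceGraph_adj_inr_inl.mpr hv)⟩
  obtain ⟨v₀, -⟩ := hH.1
  have : Nonempty (V ⊕ H.edgeSet) := ⟨.inl v₀⟩
  refine SimpleGraph.Connected.mk fun x y => ?_
  obtain ⟨u, hu⟩ := key' x
  obtain ⟨v, hv⟩ := key' y
  exact hu.trans ((key u v).trans hv.symm)

/-- A cycle in the incidence graph alternates between vertices, at even positions, and hyperedges,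
at odd ones. Its length is `2q`, and length at least 3 gives `q ≥ 2`. -/
theorem exists_isCycle_of_incidenceGraph_isCycle {v : V} (c : H.incidenceGraph.Walk (.inl v) (.inl v))
    (hc : c.IsCycle) : ∃ (q : ℕ) (v : Fin q → V) (e : Fin q → Set V), H.IsCycle v e := by
  have hpar : ∀ i ≤ c.length, ((c.getVert i).isLeft = true ↔ Even i) := by
    intro i
    induction i with
    | zero => simp
    | succ i ih =>
      intro hi
      rw [isLeft_iff_of_incidenceGraph_adj (c.adj_getVert_succ hi), Nat.even_add_one,
        ← ih (by omega)]
      simp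
  obtain ⟨q, hq⟩ : Even c.length := by
    rw [← hpar _ le_rfl, SimpleGraph.Walk.getVert_length]
    rfl
  have h3 := hc.three_le_length
  have hv : ∀ i : Fin q, ∃ x : V, c.getVert (2 * i) = .inl x := fun i => by
    rw [← Sum.isLeft_iff, hpar _ (by omega)]
    exact even_two_mul _
  have he : ∀ i : Fin q, ∃ e : H.edgeSet, c.getVert (2 * i + 1) = .inr e := fun i => by
    have := hpar (2 * i + 1) (by omega)
    rw [← Sum.isRight_iff, ← Sum.not_isLeft, this]
    simp
  choose x hx using hv
  choose e he using he
  refine ⟨q, x, fun i => (e i).1, by omega, ?_, ?_, fun i => ⟨(e i).2, ?_, ?_⟩⟩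
  · intro i j hij
    have := hc.getVert_injOn' (x₁ := 2 * i) (x₂ := 2 * j)
      (by rw [Set.mem_ofPred_eq]; omega) (by rw [Set.mem_ofPred_eq]; omega)
      (by rw [hx, hx, hij])
    omega
  · intro i j hij
    have := hc.getVert_injOn' (x₁ := 2 * i + 1) (x₂ := 2 * j + 1)
      (by rw [Set.mem_ofPred_eq]; omega) (by rw [Set.mem_ofPred_eq]; omega)
      (by rw [he, he, Subtype.ext hij])
    omega
  · have := c.adj_getVert_succ (i := 2 * i) (by omega)
    rw [hx, he] at this
    exact this
  · have := c.adj_getVert_succ (i := 2 * i + 1) (by omega)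
    -- For the last index, position `2q` is the starting point again, which matches the wrap-around
    -- of `finRotate`.
    have hrot : c.getVert (2 * i + 1 + 1) = .inl (x (finRotate q i)) := by
      rw [← hx]
      rcases Nat.lt_or_ge (i.val + 1) q with h | h
      · congr 1
        obtain ⟨n, rfl⟩ : ∃ n, q = n + 1 := ⟨q - 1, by omega⟩
        rw [coe_finRotate_of_ne_last]
        · ring
        · rintro rfl
          simp at h
      · have h0 : (finRotate q i).val = 0 := by
          obtain ⟨n, rfl⟩ : ∃ n, q = n + 1 := ⟨q - 1, by omega⟩
          rw [show i = Fin.last n from Fin.ext (by rw [Fin.val_last]; omega), finRotate_last]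
          rfl
        rw [h0, show 2 * i.val + 1 + 1 = c.length by omega]
        simp
    rw [he, hrot] at this
    exact this

theorem incidenceGraph_isAcyclic
    (hH : ∀ (q : ℕ) (v : Fin q → V) (e : Fin q → Set V), ¬ H.IsCycle v e) :
    H.incidenceGraph.IsAcyclic := by
  classical
  have key : ∀ (v : V) (c : H.incidenceGraph.Walk (.inl v) (.inl v)), ¬ c.IsCycle := by
    intro v c hc
    obtain ⟨q, v, e, h⟩ := exists_isCycle_of_incidenceGraph_isCycle c hc
    exact hH q v e h
  rintro (v | f) c hc
  · exact key v c hc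
  -- A cycle based at a hyperedge is rotated to its second node, which is a vertex.
  · have hadj := c.adj_snd hc.not_nil
    have hmem := c.getVert_mem_support 1
    change c.snd ∈ c.support at hmem
    rcases h : c.snd with w | f'
    · rw [h] at hmem
      exact key w (c.rotate _ hmem) (hc.rotate hmem)
    · rw [h] at hadj
      exact not_incidenceGraph_adj_inr_inr hadj

variable [Fintype V]

theorem incidenceGraph_degree_inl [Fintype H.edgeSet] [DecidableRel H.incidenceGraph.Adj] (v : V) :
    H.incidenceGraph.degree (.inl v) = H.deg v := by
  have h1 : H.incidenceGraph.neighborSet (.inl v) = Sum.inr '' {e : H.edgeSet | v ∈ e.1} := by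
    ext (w | e)
    · simp [not_incidenceGraph_adj_inl_inl]
    · simp [incidenceGraph_adj_inl_inr]
  have h2 : {e | e ∈ H.edgeSet ∧ v ∈ e} = Subtype.val '' {e : H.edgeSet | v ∈ e.1} := by
    ext e
    simp [and_comm]
  rw [deg, h2, Set.ncard_image_of_injective _ Subtype.val_injective,
    ← Set.ncard_image_of_injective _ Sum.inr_injective (β := V ⊕ H.edgeSet), ← h1,
    ← SimpleGraph.card_neighborSet_eq_degree, Set.ncard_eq_toFinset_card', Set.toFinset_card]

theorem incidenceGraph_degree_inr [Fintype H.edgeSet] [DecidableRel H.incidenceGraph.Adj]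
    (e : H.edgeSet) : H.incidenceGraph.degree (.inr e) = e.1.ncard := by
  have h1 : H.incidenceGraph.neighborSet (.inr e) = Sum.inl '' e.1 := by
    ext (w | e)
    · simp [incidenceGraph_adj_inr_inl]
    · simp [not_incidenceGraph_adj_inr_inr]
  rw [← Set.ncard_image_of_injective e.1 Sum.inl_injective (β := V ⊕ H.edgeSet), ← h1,
    ← SimpleGraph.card_neighborSet_eq_degree, Set.ncard_eq_toFinset_card', Set.toFinset_card]

/-- The incidence graph is a tree, so it has one edge fewer than its `n + m` nodes. Counting its
edges from the vertex side gives the degree sum, from the hyperedge side `mk`. -/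
theorem IsHypertree.card (hk : 2 ≤ k) (hV : H.vertexSet = Set.univ) (hu : H.IsUniform k)
    (hH : H.IsHypertree) :
    ∑ v, H.deg v = H.edgeSet.ncard * k ∧
      Fintype.card V + H.edgeSet.ncard = H.edgeSet.ncard * k + 1 := by
  classical
  let : Fintype H.edgeSet := Fintype.ofFinite _
  have hncard : ∀ e ∈ H.edgeSet, e.ncard = k := fun e he => by rw [Set.ncard, hu e he]; rfl
  have htree : H.incidenceGraph.IsTree :=
    ⟨incidenceGraph_connected hH.1 hV fun e he => by
      rw [← Set.ncard_pos, hncard e he]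
      omega, incidenceGraph_isAcyclic hH.2⟩
  have hcard := htree.card_edgeFinset
  have hbip : H.incidenceGraph.IsBipartiteWith
      (((Finset.univ : Finset V).map .inl : Finset (V ⊕ H.edgeSet)) : Set (V ⊕ H.edgeSet))
      ((Finset.univ : Finset H.edgeSet).map .inr : Finset (V ⊕ H.edgeSet)) := by
    refine ⟨?_, ?_⟩
    · rw [Finset.disjoint_coe, Finset.disjoint_left]
      simp
    · rintro (v | e) (w | f) h
      · exact absurd h not_incidenceGraph_adj_inl_inl
      · simp
      · simp
      · exact absurd h not_incidenceGraph_adj_inr_inr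
  have h1 := SimpleGraph.isBipartiteWith_sum_degrees_eq_card_edges hbip
  have h2 := SimpleGraph.isBipartiteWith_sum_degrees_eq_card_edges' hbip
  have hE : Fintype.card H.edgeSet = H.edgeSet.ncard := by
    rw [Set.ncard_eq_toFinset_card', Set.toFinset_card]
  rw [Finset.sum_map] at h1 h2
  have h1' : ∑ v, H.deg v = H.incidenceGraph.edgeFinset.card := by
    rw [← h1]
    exact Finset.sum_congr rfl fun v _ => (incidenceGraph_degree_inl v).symm
  have h2' : H.edgeSet.ncard * k = H.incidenceGraph.edgeFinset.card := by
    have : ∀ e ∈ (Finset.univ : Finset H.edgeSet),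
        H.incidenceGraph.degree (Function.Embedding.inr e) = k := fun e _ =>
      (incidenceGraph_degree_inr e).trans (hncard e.1 e.2)
    rw [← h2, Finset.sum_congr rfl this, Finset.sum_const, Finset.card_univ, hE, smul_eq_mul]
  refine ⟨h1'.trans h2'.symm, ?_⟩
  rw [h2', hcard, Fintype.card_sum, hE]

/-- There are at least two vertices, and a walk from `v` to another one begins in a hyperedge
containing `v`. -/
theorem IsHypertree.one_le_deg (hk : 2 ≤ k) (hV : H.vertexSet = Set.univ) (hu : H.IsUniform k)
    (hH : H.IsHypertree) (hm : 1 ≤ H.edgeSet.ncard) (v : V) : 1 ≤ H.deg v := by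
  have hcard : 1 < Fintype.card V := by
    have := (hH.card hk hV hu).2
    nlinarith
  obtain ⟨w, hw⟩ := Fintype.exists_ne_of_one_lt_card hcard v
  have hvw := hH.1.2 v (hV ▸ Set.mem_univ v) w (hV ▸ Set.mem_univ w)
  obtain rfl | ⟨u, ⟨e, he, hv, -⟩, -⟩ := Relation.ReflTransGen.cases_head hvw
  · exact absurd rfl hw
  · exact (Set.ncard_pos).mpr ⟨e, he, hv⟩

end Hypergraph

/-! ### Starlike hypertrees -/

namespace Hypergraph

/-- There are no cycles if all hyperedges are either pendant, that is, attached to the other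
hyperedges in at most one vertex, or meet one another at most in `c`. -/
theorem not_isCycle_of_pendant_or_center {V : Type*} {H : Hypergraph V} (c : V) (P : Set V → Prop)
    (hP : ∀ f ∈ H.edgeSet, P f → ∀ e ∈ H.edgeSet, ∀ e' ∈ H.edgeSet, e ≠ f → e' ≠ f →
      ∀ x ∈ e ∩ f, ∀ y ∈ e' ∩ f, x = y)
    (hc : ∀ e ∈ H.edgeSet, ∀ f ∈ H.edgeSet, ¬ P e → ¬ P f → e ≠ f → ∀ x ∈ e ∩ f, x = c)
    (q : ℕ) (v : Fin q → V) (e : Fin q → Set V) : ¬ H.IsCycle v e := by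
  rintro ⟨hq, hv, he, h⟩
  obtain ⟨n, rfl⟩ : ∃ n, q = n + 2 := ⟨q - 2, by omega⟩
  have hrot : ∀ i, finRotate (n + 2) i ≠ i := fun i hi => by
    rw [finRotate_apply] at hi
    simp at hi
  -- A pendant hyperedge of a cycle would meet its predecessor and its successor in two distinct
  -- vertices. These two hyperedges coincide when `q = 2`, which `hP` permits.
  have hnP : ∀ i, ¬ P (e i) := by
    intro i hi
    obtain ⟨j, rfl⟩ := (finRotate (n + 2)).surjective i
    refine hrot _ (hv (hP _ (h (finRotate _ j)).1 hi _ (h (finRotate _ (finRotate _ j))).1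
      _ (h j).1 (fun h1 => hrot _ (he h1)) (fun h1 => hrot _ (he h1).symm) _
      ⟨(h _).2.1, (h _).2.2⟩ _ ⟨(h _).2.2, (h _).2.1⟩))
  have hall : ∀ i, v (finRotate _ i) = c := fun i =>
    hc _ (h i).1 _ (h (finRotate _ i)).1 (hnP _) (hnP _) (fun h1 => hrot _ (he h1).symm) _
      ⟨(h i).2.2, (h _).2.1⟩
  exact hrot _ (hv ((hall (finRotate _ 0)).trans (hall 0).symm))

end Hypergraph

namespace FinHypergraph

section Starlike

variable {k r : ℕ} {ℓ : Fin r → ℕ}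

/-- The `j`-th hyperedge on leg `i`. -/
def legEdge (k : ℕ) {r : ℕ} (ℓ : Fin r → ℕ) (i : Fin r) (j : ℕ) : Set (StarlikeVertex k ℓ) :=
  {x | ∃ p, j * (k - 1) ≤ p ∧ p ≤ (j + 1) * (k - 1) ∧ AtPosition i p x}

theorem legEdge_mem {i : Fin r} {j : ℕ} (hj : j < ℓ i) :
    legEdge k ℓ i j ∈ (starlike k ℓ).graph.edgeSet := ⟨i, j, hj, rfl⟩

/-- This and the next lemmas make leg and position coordinates on the starlike hypertree, the leg
being ambiguous only at position 0. -/
theorem AtPosition.eq {i : Fin r} {p : ℕ} {x y : StarlikeVertex k ℓ} (hx : AtPosition i p x)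
    (hy : AtPosition i p y) : x = y := by
  rcases x with _ | ⟨i₁, p₁⟩ <;> rcases y with _ | ⟨i₂, p₂⟩
  · rfl
  · simp only [AtPosition] at hx hy
    omega
  · simp only [AtPosition] at hx hy
    omega
  · obtain ⟨rfl, h1⟩ := hx
    obtain ⟨h0, h2⟩ := hy
    simp only at h0
    subst h0
    congr 2
    ext
    simp only at h1 h2
    omega

theorem AtPosition.eq_pos {i : Fin r} {p q : ℕ} {x : StarlikeVertex k ℓ} (hx : AtPosition i p x)
    (hy : AtPosition i q x) : p = q := by
  rcases x with _ | ⟨i₁, p₁⟩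
  · exact Eq.trans (b := 0) hx (Eq.symm hy)
  · exact hx.2.trans hy.2.symm

theorem AtPosition.eq_leg {i i' : Fin r} {p q : ℕ} {x : StarlikeVertex k ℓ} (hx : AtPosition i p x)
    (hy : AtPosition i' q x) (hp : p ≠ 0) : i = i' := by
  rcases x with _ | ⟨i₁, p₁⟩
  · exact absurd hx hp
  · exact hx.1.symm.trans hy.1

theorem AtPosition.eq_none {i : Fin r} {x : StarlikeVertex k ℓ} (hx : AtPosition i 0 x) :
    x = none := hx.eq (y := none) rfl

theorem exists_atPosition (i : Fin r) {p : ℕ} (hp : p ≤ ℓ i * (k - 1)) :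
    ∃ x : StarlikeVertex k ℓ, AtPosition i p x := by
  rcases Nat.eq_zero_or_pos p with rfl | h
  · exact ⟨none, rfl⟩
  · exact ⟨some ⟨i, ⟨p - 1, by omega⟩⟩, rfl, by simp only; omega⟩

theorem mul_le_leg_length {i : Fin r} {j p : ℕ} (hj : j < ℓ i) (hp : p ≤ (j + 1) * (k - 1)) :
    p ≤ ℓ i * (k - 1) := hp.trans (Nat.mul_le_mul_right _ hj)

/-- The image of a hyperedge under a map that is given on each leg in terms of positions. -/
theorem image_legEdge {W : Type*} (τ : StarlikeVertex k ℓ → W) (g : Fin r → ℕ → W)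
    (hτ : ∀ i p x, AtPosition i p x → τ x = g i p) {i : Fin r} {j : ℕ} (hj : j < ℓ i) :
    τ '' legEdge k ℓ i j = g i '' Set.Icc (j * (k - 1)) ((j + 1) * (k - 1)) := by
  ext y
  constructor
  · rintro ⟨x, ⟨p, h1, h2, h3⟩, rfl⟩
    exact ⟨p, ⟨h1, h2⟩, (hτ i p x h3).symm⟩
  · rintro ⟨p, ⟨h1, h2⟩, rfl⟩
    obtain ⟨x, hx⟩ := exists_atPosition i (mul_le_leg_length hj h2)
    exact ⟨x, ⟨p, h1, h2, hx⟩, hτ i p x hx⟩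

theorem legEdge_encard (hk : 2 ≤ k) {i : Fin r} {j : ℕ} (hj : j < ℓ i) :
    (legEdge k ℓ i j).encard = k := by
  choose x hx using fun p : Set.Icc (j * (k - 1)) ((j + 1) * (k - 1)) =>
    exists_atPosition i (mul_le_leg_length hj p.2.2)
  have hr : legEdge k ℓ i j = Set.range x := by
    ext y
    constructor
    · rintro ⟨p, h1, h2, h3⟩
      exact ⟨⟨p, h1, h2⟩, (hx _).eq h3⟩
    · rintro ⟨p, rfl⟩
      exact ⟨p, p.2.1, p.2.2, hx p⟩
  have hinj : Function.Injective x := fun p q hpq => by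
    have h := hx p
    rw [hpq] at h
    exact Subtype.ext (h.eq_pos (hx q))
  rw [hr, ← Set.image_univ, hinj.encard_image, Set.encard_univ, ENat.card_eq_coe_fintype_card,
    Fintype.card_ofFinset, Nat.card_Icc, Nat.succ_mul]
  congr 1
  omega

theorem legEdge_injective (hk : 2 ≤ k) {i i' : Fin r} {j j' : ℕ} (hj : j < ℓ i) (hj' : j' < ℓ i')
    (h : legEdge k ℓ i j = legEdge k ℓ i' j') : i = i' ∧ j = j' := by
  have key : ∀ {i i' : Fin r} {j j' : ℕ}, j < ℓ i → legEdge k ℓ i j = legEdge k ℓ i' j' →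
      i = i' ∧ j ≤ j' := by
    intro i i' j j' hj h
    -- The last vertex of the hyperedge has nonzero position, so it determines the leg; its position
    -- bounds `j` by `j'`.
    obtain ⟨x, hx⟩ := exists_atPosition (ℓ := ℓ) (k := k) i
      (mul_le_leg_length hj (le_refl ((j + 1) * (k - 1))))
    have hmem : x ∈ legEdge k ℓ i j :=
      ⟨_, Nat.mul_le_mul_right _ (Nat.le_succ j), le_rfl, hx⟩
    rw [h] at hmem
    obtain ⟨p, -, hp, hxp⟩ := hmem
    have h0 : (j + 1) * (k - 1) ≠ 0 := Nat.mul_ne_zero (by omega) (by omega)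
    obtain rfl := hx.eq_leg hxp h0
    rw [← hx.eq_pos hxp] at hp
    exact ⟨rfl, by have := Nat.le_of_mul_le_mul_right hp (by omega); omega⟩
  exact ⟨(key hj h).1, le_antisymm (key hj h).2 (key hj' h.symm).2⟩

theorem starlike_edgeSet_ncard (hk : 2 ≤ k) :
    (starlike k ℓ).graph.edgeSet.ncard = ∑ i, ℓ i := by
  have h1 : (starlike k ℓ).graph.edgeSet =
      Set.range fun s : Σ i, Fin (ℓ i) => legEdge k ℓ s.1 s.2 := by
    refine Set.ext fun e => ⟨?_, ?_⟩
    · rintro ⟨i, j, hj, rfl⟩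
      exact ⟨⟨i, j, hj⟩, rfl⟩
    · rintro ⟨s, rfl⟩
      exact ⟨s.1, s.2, s.2.2, rfl⟩
  have h2 : Function.Injective fun s : Σ i, Fin (ℓ i) => legEdge k ℓ s.1 s.2 := by
    rintro ⟨i, j, hj⟩ ⟨i', j', hj'⟩ h
    obtain ⟨rfl, rfl⟩ := legEdge_injective hk hj hj' h
    rfl
  refine (congrArg Set.ncard h1).trans ?_
  have h3 : (Set.range fun s : Σ i, Fin (ℓ i) => legEdge k ℓ s.1 s.2).ncard = ∑ i, ℓ i := by
    rw [← Set.image_univ, Set.ncard_image_of_injective _ h2, Set.ncard_univ]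
    simp
  exact h3

theorem starlike_isConnected (hk : 2 ≤ k) : (starlike k ℓ).graph.IsConnected := by
  have key : ∀ (i : Fin r) (j : ℕ), j < ℓ i → ∀ x ∈ legEdge k ℓ i j,
      Relation.ReflTransGen (starlike k ℓ).graph.Adj none x := by
    intro i j
    induction j with
    | zero =>
      intro hj x hx
      exact .single ⟨_, legEdge_mem hj, ⟨0, by simp, by simp, rfl⟩, hx⟩
    | succ j ih =>
      intro hj x hx
      obtain ⟨y, hy⟩ := exists_atPosition (ℓ := ℓ) (k := k) i
        (mul_le_leg_length (Nat.lt_of_succ_lt hj) (le_refl ((j + 1) * (k - 1))))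
      refine (ih (Nat.lt_of_succ_lt hj) y
        ⟨_, Nat.mul_le_mul_right _ (Nat.le_succ j), le_rfl, hy⟩).tail
        ⟨_, legEdge_mem hj, ⟨_, le_rfl, Nat.mul_le_mul_right _ (Nat.le_succ _), hy⟩, hx⟩
  have key' : ∀ x, Relation.ReflTransGen (starlike k ℓ).graph.Adj none x := by
    rintro (_ | ⟨i, p⟩)
    · exact .refl
    -- The index `p` is stored from 0 but stands for position `p + 1`, which lies on hyperedge
    -- number `⌊p / (k-1)⌋`.
    · refine key i (p.val / (k - 1)) ?_ _ ⟨p.val + 1, ?_, ?_, rfl, rfl⟩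
      · exact Nat.div_lt_of_lt_mul (p.2.trans_eq (mul_comm _ _))
      · exact (Nat.div_mul_le_self _ _).trans (Nat.le_succ _)
      · exact (Nat.lt_mul_div_succ p.val (by omega)).trans_eq (mul_comm _ _)
  refine ⟨⟨none, Set.mem_univ _⟩, fun u _ v _ => .trans ?_ (key' v)⟩
  have : Std.Symm (starlike k ℓ).graph.Adj := ⟨fun _ _ h => h.symm⟩
  exact Relation.ReflTransGen.stdSymm.symm _ _ (key' u)

/-- Starlike hypertrees with legs of length at most `2` have no cycles. -/
theorem starlike_isHypertree (hk : 2 ≤ k) (hℓ : ∀ i, ℓ i ≤ 2) :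
    (starlike k ℓ).graph.IsHypertree := by
  refine ⟨starlike_isConnected hk, Hypergraph.not_isCycle_of_pendant_or_center (none : StarlikeVertex k ℓ)
    -- The pendant hyperedges are the second ones on legs of length 2, attached only at position `k
    -- - 1`. First hyperedges of different legs meet only in the common vertex.
    (fun e => ∃ i, 1 < ℓ i ∧ e = legEdge k ℓ i 1) ?_ ?_⟩
  · rintro _ - ⟨i, hi, rfl⟩
    have key : ∀ e ∈ (starlike k ℓ).graph.edgeSet, e ≠ legEdge k ℓ i 1 →
        ∀ x ∈ e ∩ legEdge k ℓ i 1, AtPosition i (k - 1) x := by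
      rintro _ ⟨i', j', hj', rfl⟩ hne x ⟨⟨p', h1', h2', h3'⟩, ⟨p, h1, h2, h3⟩⟩
      obtain rfl : i = i' := h3.eq_leg h3' (by omega)
      have hj0 : j' = 0 := by
        have := hℓ i
        by_contra h0
        obtain rfl : j' = 1 := by omega
        exact hne rfl
      obtain rfl := h3.eq_pos h3'
      subst hj0
      obtain rfl : p = k - 1 := by omega
      exact h3
    intro e he e' he' hne hne' x hx y hy
    exact (key e he hne x hx).eq (key e' he' hne' y hy)
  · have key : ∀ e ∈ (starlike k ℓ).graph.edgeSet, (¬ ∃ i, 1 < ℓ i ∧ e = legEdge k ℓ i 1) →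
        ∃ i, e = legEdge k ℓ i 0 := by
      rintro _ ⟨i, j, hj, rfl⟩ h
      refine ⟨i, ?_⟩
      have := hℓ i
      rcases Nat.eq_zero_or_pos j with rfl | h0
      · rfl
      · obtain rfl : j = 1 := by omega
        exact absurd ⟨i, hj, rfl⟩ h
    intro e he f hf hPe hPf hne x hx
    obtain ⟨i, rfl⟩ := key e he hPe
    obtain ⟨i', rfl⟩ := key f hf hPf
    obtain ⟨⟨p, -, -, hp⟩, ⟨p', -, -, hp'⟩⟩ := hx
    rcases Nat.eq_zero_or_pos p with rfl | h0
    · exact hp.eq_none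
    · exact absurd (congrArg (legEdge k ℓ · 0) (hp.eq_leg hp' h0.ne')) hne

theorem starlike_isUniformHypertree (hk : 2 ≤ k) (hℓ : ∀ i, ℓ i ≤ 2) :
    IsUniformHypertree k (∑ i, ℓ i) (starlike k ℓ) := by
  refine ⟨?_, starlike_isHypertree hk hℓ, starlike_edgeSet_ncard hk⟩
  rintro _ ⟨i, j, hj, rfl⟩
  exact legEdge_encard hk hj

theorem le_deg_starlike_center (hk : 2 ≤ k) (hℓ : ∀ i, 1 ≤ ℓ i) :
    r ≤ (starlike k ℓ).graph.deg (none : StarlikeVertex k ℓ) := by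
  have hinj : Function.Injective fun i : Fin r => legEdge k ℓ i 0 := fun i i' h =>
    (legEdge_injective hk (hℓ i) (hℓ i') h).1
  calc r = (Set.range fun i : Fin r => legEdge k ℓ i 0).ncard := by
        rw [← Set.image_univ, Set.ncard_image_of_injective _ hinj, Set.ncard_univ, Nat.card_fin]
    _ ≤ _ := by
        refine Set.ncard_le_ncard ?_ (Set.toFinite (α := Set (StarlikeVertex k ℓ)) _)
        rintro _ ⟨i, rfl⟩
        exact ⟨legEdge_mem (hℓ i), 0, by simp, by simp, rfl⟩

end Starlike

/-! ### Recognizing starlike hypertrees -/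

section Recognition

variable {k m r : ℕ} {ℓ : Fin r → ℕ} {T : FinHypergraph}

theorem IsUniformHypertree.card_add (hk : 2 ≤ k) (hT : IsUniformHypertree k m T) :
    Fintype.card T.V + m = m * k + 1 := by
  have := (hT.2.1.card hk T.vertexSet_eq hT.1).2
  rwa [hT.2.2] at this

theorem IsUniformHypertree.sum_deg (hk : 2 ≤ k) (hT : IsUniformHypertree k m T) :
    ∑ v, T.graph.deg v = m * k := by
  have := (hT.2.1.card hk T.vertexSet_eq hT.1).1
  rwa [hT.2.2] at this

theorem IsUniformHypertree.one_le_deg (hk : 2 ≤ k) (hm : 1 ≤ m) (hT : IsUniformHypertree k m T)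
    (v : T.V) : 1 ≤ T.graph.deg v :=
  hT.2.1.one_le_deg hk T.vertexSet_eq hT.1 (by rw [hT.2.2]; exact hm) v

/-- Here `g i p` is the vertex to be placed at position `p` of leg `i`. Every vertex lies in a
hyperedge, so the placement is onto; both sides have `m(k-1) + 1` vertices, so injectivity is
automatic. -/
theorem iso_starlike (hk : 2 ≤ k) (hm : 1 ≤ m) (hT : IsUniformHypertree k m T)
    (hℓ : ∑ i, ℓ i = m) (v : T.V) (g : Fin r → ℕ → T.V) (hg : ∀ i, g i 0 = v)
    (h1 : ∀ i, ∀ j < ℓ i,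
      g i '' Set.Icc (j * (k - 1)) ((j + 1) * (k - 1)) ∈ T.graph.edgeSet)
    (h2 : ∀ e ∈ T.graph.edgeSet, ∃ i, ∃ j < ℓ i,
      g i '' Set.Icc (j * (k - 1)) ((j + 1) * (k - 1)) = e) :
    Iso T (starlike k ℓ) := by
  let τ : StarlikeVertex k ℓ → T.V
    | none => v
    | some y => g y.1 (y.2.val + 1)
  have hτ : ∀ i p x, AtPosition i p x → τ x = g i p := by
    rintro i p (_ | y) hx
    · obtain rfl : p = 0 := hx
      exact (hg i).symm
    · obtain ⟨rfl, rfl⟩ := hx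
      rfl
  have hsurj : Function.Surjective τ := by
    intro w
    obtain ⟨e, he, hw⟩ := (Set.ncard_pos).mp (hT.one_le_deg hk hm w)
    obtain ⟨i, j, hj, rfl⟩ := h2 e he
    rw [← image_legEdge τ g hτ hj] at hw
    obtain ⟨x, -, hx⟩ := hw
    exact ⟨x, hx⟩
  have hcard : Fintype.card (StarlikeVertex k ℓ) = Fintype.card T.V := by
    have := hT.card_add hk
    rw [Fintype.card_option, Fintype.card_sigma]
    simp only [Fintype.card_fin]
    rw [← Finset.sum_mul, hℓ]
    obtain ⟨n, rfl⟩ : ∃ n, k = n + 1 := ⟨k - 1, by omega⟩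
    rw [Nat.mul_succ] at this
    simp only [Nat.add_sub_cancel]
    omega
  have hbij : Function.Bijective τ := (Fintype.bijective_iff_surjective_and_card τ).mpr ⟨hsurj, hcard⟩
  let σ : T.V ≃ StarlikeVertex k ℓ := (Equiv.ofBijective τ hbij).symm
  have hσ : ∀ s : Set (StarlikeVertex k ℓ), σ '' (τ '' s) = s := fun s => by
    rw [Set.image_image]
    convert Set.image_id s with x
    exact (Equiv.ofBijective τ hbij).symm_apply_apply x
  refine ⟨σ, Hypergraph.ext ?_ ?_⟩
  · rw [Hypergraph.image_vertexSet, T.vertexSet_eq, Set.image_univ]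
    exact σ.surjective.range_eq
  · ext e
    rw [Hypergraph.mem_edgeSet_image]
    constructor
    · rintro ⟨e', he', rfl⟩
      obtain ⟨i, j, hj, rfl⟩ := h2 e' he'
      rw [← image_legEdge τ g hτ hj]
      exact ⟨i, j, hj, hσ _⟩
    · rintro ⟨i, j, hj, rfl⟩
      refine ⟨τ '' legEdge k ℓ i j, ?_, hσ _⟩
      rw [image_legEdge τ g hτ hj]
      exact h1 i j hj

theorem exists_image_Ico_eq {W : Type*} [Nonempty W] (s : Set W) (hs : s.Finite) (a n : ℕ)
    (h : s.ncard = n) : ∃ g : ℕ → W, g '' Set.Ico a (a + n) = s := by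
  have : Finite s := hs
  let φ : s ≃ Fin n := Finite.equivFinOfCardEq h
  refine ⟨fun p => if hp : p - a < n then φ.symm ⟨p - a, hp⟩ else Classical.arbitrary W, ?_⟩
  ext y
  constructor
  · rintro ⟨p, ⟨h1, h2⟩, rfl⟩
    simp only
    rw [dif_pos (by omega)]
    exact (φ.symm _).2
  · intro hy
    refine ⟨a + φ ⟨y, hy⟩, ⟨by omega, by have := (φ ⟨y, hy⟩).2; omega⟩, ?_⟩
    simp

/-- Labels a hyperedge by consecutive positions with a prescribed first vertex, as `iso_starlike`
requires. -/
theorem exists_image_Icc_eq {W : Type*} {e : Set W} {v : W} {n : ℕ} (he : e.ncard = n + 1)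
    (hv : v ∈ e) (a : ℕ) : ∃ g : ℕ → W, g a = v ∧ g '' Set.Icc a (a + n) = e := by
  have hfin : e.Finite := Set.finite_of_ncard_pos (by omega)
  have : Nonempty W := ⟨v⟩
  obtain ⟨g, hg⟩ := exists_image_Ico_eq (e \ {v}) hfin.sdiff (a + 1) n
    (by rw [Set.ncard_sdiff_singleton_of_mem hv]; omega)
  refine ⟨Function.update g a v, by simp, ?_⟩
  have h1 : Set.Icc a (a + n) = insert a (Set.Ico (a + 1) (a + 1 + n)) := by
    ext p
    simp only [Set.mem_Icc, Set.mem_insert_iff, Set.mem_Ico]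
    omega
  have h2 : Function.update g a v '' Set.Ico (a + 1) (a + 1 + n) =
      g '' Set.Ico (a + 1) (a + 1 + n) :=
    Set.image_congr fun p hp => Function.update_of_ne (by have := hp.1; omega) _ _
  rw [h1, Set.image_insert_eq, h2, hg, Function.update_self, Set.insert_sdiff_singleton,
    Set.insert_eq_of_mem hv]

theorem exists_image_Icc_eq₂ {W : Type*} {e : Set W} {u v : W} {n : ℕ} (he : e.ncard = n + 2)
    (hv : v ∈ e) (hu : u ∈ e) (huv : u ≠ v) :
    ∃ g : ℕ → W, g 0 = v ∧ g (n + 1) = u ∧ g '' Set.Icc 0 (n + 1) = e := by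
  obtain ⟨g, hg0, hg⟩ := exists_image_Icc_eq (e := e \ {u}) (v := v) (n := n)
    (by rw [Set.ncard_sdiff_singleton_of_mem hu]; omega) ⟨hv, huv.symm⟩ 0
  refine ⟨Function.update g (n + 1) u, by simp [hg0], by simp, ?_⟩
  have h1 : Set.Icc 0 (n + 1) = insert (n + 1) (Set.Icc 0 (0 + n)) := by
    ext p
    simp only [Set.mem_Icc, Set.mem_insert_iff]
    omega
  have h2 : Function.update g (n + 1) u '' Set.Icc 0 (0 + n) = g '' Set.Icc 0 (0 + n) :=
    Set.image_congr fun p hp => Function.update_of_ne (by have := hp.2; omega) _ _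
  rw [h1, Set.image_insert_eq, h2, hg, Function.update_self, Set.insert_sdiff_singleton,
    Set.insert_eq_of_mem hu]

end Recognition

end FinHypergraph

namespace FinHypergraph

/-! ### Hypertrees with a vertex of degree `m` or `m - 1`. -/

section Recognition

variable {k m : ℕ} {T : FinHypergraph}

theorem IsUniformHypertree.ncard_edge (hT : IsUniformHypertree k m T) {e : Set T.V}
    (he : e ∈ T.graph.edgeSet) : e.ncard = k := by
  rw [Set.ncard, hT.1 e he]
  rfl

theorem IsUniformHypertree.deg_le (hT : IsUniformHypertree k m T) (v : T.V) :
    T.graph.deg v ≤ m := by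
  rw [← hT.2.2]
  exact Set.ncard_le_ncard (fun e he => he.1) (Set.toFinite _)

theorem iso_starlike_of_deg_eq (hk : 2 ≤ k) (hm : 1 ≤ m) (hT : IsUniformHypertree k m T) (v : T.V)
    (hv : T.graph.deg v = m) : Iso T (starlike k fun _ : Fin m => 1) := by
  have hall : {e | e ∈ T.graph.edgeSet ∧ v ∈ e} = T.graph.edgeSet :=
    Set.eq_of_subset_of_ncard_le (fun e he => he.1) (by rw [hT.2.2]; exact hv.ge) (Set.toFinite _)
  let φ : {e | e ∈ T.graph.edgeSet ∧ v ∈ e} ≃ Fin m := Finite.equivFinOfCardEq hv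
  choose g hg0 hg using fun e : {e | e ∈ T.graph.edgeSet ∧ v ∈ e} =>
    exists_image_Icc_eq (n := k - 1) (by rw [hT.ncard_edge e.2.1]; omega) e.2.2 0
  refine iso_starlike hk hm hT (by simp) v (fun i => g (φ.symm i)) (fun i => hg0 _) ?_ ?_
  · intro i j hj
    obtain rfl : j = 0 := by omega
    rw [zero_mul, zero_add, one_mul]
    have := hg (φ.symm i)
    rw [zero_add] at this
    rw [this]
    exact (φ.symm i).2.1
  · intro e he
    have he' : e ∈ {e | e ∈ T.graph.edgeSet ∧ v ∈ e} := by rwa [hall]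
    refine ⟨φ ⟨e, he'⟩, 0, Nat.one_pos, ?_⟩
    have := hg ⟨e, he'⟩
    rw [zero_mul, zero_add, one_mul, Equiv.symm_apply_apply]
    rwa [zero_add] at this

/-- The leg lengths `1, 2, 1, …, 1`. -/
abbrev nearStarLegs (m : ℕ) : Fin (m - 1) → ℕ := fun i => if i.val = 1 then 2 else 1

theorem sum_nearStarLegs (hm : 3 ≤ m) : ∑ i, nearStarLegs m i = m := by
  have h : ∀ i : Fin (m - 1), nearStarLegs m i = 1 + if i = ⟨1, by omega⟩ then 1 else 0 := by
    intro i
    simp only [nearStarLegs, Fin.ext_iff]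
    split_ifs <;> rfl
  rw [Finset.sum_congr rfl fun i _ => h i, Finset.sum_add_distrib]
  simp
  omega

theorem exists_pendant_of_deg_add_one_eq (hk : 2 ≤ k) (hT : IsUniformHypertree k m T) (v : T.V)
    (hv : T.graph.deg v + 1 = m) : ∃ f ∈ T.graph.edgeSet, v ∉ f ∧
      (∀ e ∈ T.graph.edgeSet, e ≠ f → v ∈ e) ∧ ∃ e ∈ T.graph.edgeSet, v ∈ e ∧ ∃ u ∈ e, u ∈ f := by
  have h1 : (T.graph.edgeSet \ {e | e ∈ T.graph.edgeSet ∧ v ∈ e}).ncard = 1 := by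
    have := Set.ncard_sdiff_add_ncard_of_subset (s := {e | e ∈ T.graph.edgeSet ∧ v ∈ e})
      (t := T.graph.edgeSet) (fun e he => he.1) (Set.toFinite _)
    rw [hT.2.2] at this
    change _ + T.graph.deg v = m at this
    omega
  obtain ⟨f, hf⟩ := Set.ncard_eq_one.mp h1
  have hff : f ∈ T.graph.edgeSet \ {e | e ∈ T.graph.edgeSet ∧ v ∈ e} := hf ▸ Set.mem_singleton f
  have hvf : v ∉ f := fun h => hff.2 ⟨hff.1, h⟩
  have hother : ∀ e ∈ T.graph.edgeSet, e ≠ f → v ∈ e := by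
    intro e he hne
    by_contra hve
    have : e ∈ T.graph.edgeSet \ {e | e ∈ T.graph.edgeSet ∧ v ∈ e} := ⟨he, fun h => hve h.2⟩
    rw [hf] at this
    exact hne this
  refine ⟨f, hff.1, hvf, hother, ?_⟩
  obtain ⟨w, hw⟩ : f.Nonempty := by
    rw [← Set.ncard_pos, hT.ncard_edge hff.1]
    omega
  have hvw := hT.2.1.1.2 v (T.vertexSet_eq ▸ Set.mem_univ v) w (T.vertexSet_eq ▸ Set.mem_univ w)
  -- A walk from `v` to `f` enters `f` through a hyperedge other than `f`, and every such hyperedge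
  -- contains `v`.
  have key : ∃ x y, x ∉ f ∧ y ∈ f ∧ T.graph.Adj x y := by
    induction hvw with
    | refl => exact absurd hw hvf
    | @tail b c _ hbc ih =>
      by_cases hb : b ∈ f
      · exact ih hb
      · exact ⟨b, c, hb, hw, hbc⟩
  obtain ⟨x, y, hx, hy, e, he, hxe, hye⟩ := key
  exact ⟨e, he, hother e he fun h => hx (h ▸ hxe), y, hye, hy⟩

theorem iso_nearStar_of_deg_add_one_eq (hk : 2 ≤ k) (hm : 3 ≤ m) (hT : IsUniformHypertree k m T)
    (v : T.V) (hv : T.graph.deg v + 1 = m) : Iso T (starlike k (nearStarLegs m)) := by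
  obtain ⟨f, hf, hvf, hother, e₁, he₁, hve₁, u, hue₁, huf⟩ :=
    exists_pendant_of_deg_add_one_eq hk hT v hv
  let E := {e | e ∈ T.graph.edgeSet ∧ v ∈ e}
  have hE : Nat.card E = m - 1 := by
    change T.graph.deg v = m - 1
    omega
  let one : Fin (m - 1) := ⟨1, by omega⟩
  -- The hyperedge that carries `f` must go on leg 1, the leg of length 2; a transposition arranges
  -- this.
  obtain ⟨φ, hφ⟩ : ∃ φ : Fin (m - 1) ≃ E, φ one = ⟨e₁, he₁, hve₁⟩ := by
    let ψ : Fin (m - 1) ≃ E := (Finite.equivFinOfCardEq hE).symm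
    exact ⟨(Equiv.swap one (ψ.symm ⟨e₁, he₁, hve₁⟩)).trans ψ, by simp⟩
  have huv : u ≠ v := fun h => hvf (h ▸ huf)
  obtain ⟨n, rfl⟩ : ∃ n, k = n + 2 := ⟨k - 2, by omega⟩
  obtain ⟨g₁, hg₁0, hg₁u, hg₁⟩ := exists_image_Icc_eq₂ (n := n) (hT.ncard_edge he₁) hve₁ hue₁ huv
  obtain ⟨g₂, hg₂u, hg₂⟩ := exists_image_Icc_eq (n := n + 1) (hT.ncard_edge hf) huf (n + 1)
  choose g hg0 hg using fun e : E =>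
    exists_image_Icc_eq (n := n + 1) (hT.ncard_edge e.2.1) e.2.2 0
  -- On the long leg the labellings of `e₁` and `f` are glued at position `n + 1 = k - 1`, where
  -- both take the value `u`.
  let G : Fin (m - 1) → ℕ → T.V := fun i p =>
    if i = one then if p ≤ n + 1 then g₁ p else g₂ p else g (φ i) p
  have hG0 : ∀ i, G i '' Set.Icc 0 (n + 1) = φ i := by
    intro i
    by_cases hi : i = one
    · subst hi
      rw [hφ]
      refine Eq.trans (Set.image_congr fun p hp => ?_) hg₁
      simp only [G, if_true, if_pos hp.2]
    · have := hg (φ i)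
      rw [zero_add] at this
      refine Eq.trans (Set.image_congr fun p hp => ?_) this
      simp only [G, if_neg hi]
  have hG1 : G one '' Set.Icc (n + 1) (n + 1 + (n + 1)) = f := by
    refine Eq.trans (Set.image_congr fun p hp => ?_) hg₂
    simp only [G, if_true]
    split_ifs with h
    · obtain rfl : p = n + 1 := le_antisymm h hp.1
      rw [hg₁u, hg₂u]
    · rfl
  have hk1 : n + 2 - 1 = n + 1 := rfl
  have hleg : nearStarLegs m one = 2 := if_pos rfl
  refine iso_starlike hk (by omega) hT (sum_nearStarLegs hm) v G ?_ ?_ ?_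
  · intro i
    by_cases hi : i = one
    · simp only [G, if_pos hi, if_pos (Nat.zero_le _), hg₁0]
    · simp only [G, if_neg hi, hg0]
  · intro i j hj
    rw [hk1]
    rcases Nat.eq_zero_or_pos j with rfl | hj0
    · rw [zero_mul, zero_add, one_mul, hG0]
      exact (φ i).2.1
    · have hi : i = one := by
        by_contra hi
        have : nearStarLegs m i = 1 := if_neg fun h => hi (Fin.ext h)
        omega
      subst hi
      obtain rfl : j = 1 := by omega
      rw [one_mul, add_mul, one_mul, hG1]
      exact hf
  · intro e he
    rw [hk1]
    by_cases hef : e = f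
    · subst hef
      exact ⟨one, 1, by omega, by rw [one_mul, add_mul, one_mul, hG1]⟩
    · refine ⟨φ.symm ⟨e, he, hother e he hef⟩, 0, ?_, ?_⟩
      · simp only [nearStarLegs]
        split_ifs <;> omega
      · rw [zero_mul, zero_add, one_mul, hG0, Equiv.apply_symm_apply]

/-- The preimage of the star's centre would lie in every hyperedge, but the hyperedge on leg 0 and
the second one on leg 1 are disjoint. -/
theorem not_iso_nearStar_star (hk : 2 ≤ k) (hm : 3 ≤ m) :
    ¬ Iso (starlike k (nearStarLegs m)) (starlike k fun _ : Fin m => 1) := by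
  rintro ⟨σ, hσ⟩
  have key : ∀ (i : Fin (m - 1)) (j : ℕ), j < nearStarLegs m i →
      ∃ p, j * (k - 1) ≤ p ∧ AtPosition i p (σ.symm none) := by
    intro i j hj
    have h1 : σ '' legEdge k (nearStarLegs m) i j ∈
        ((starlike k (nearStarLegs m)).graph.image σ).edgeSet :=
      Hypergraph.image_mem_edgeSet_image (legEdge_mem hj)
    rw [hσ] at h1
    obtain ⟨i', j', hj', h2⟩ := h1
    obtain rfl : j' = 0 := Nat.lt_one_iff.mp hj'
    have h3 : none ∈ legEdge k (fun _ : Fin m => 1) i' 0 := ⟨0, by simp, by simp, rfl⟩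
    obtain ⟨x, ⟨p, hp, -, hx⟩, hxn⟩ := h2.ge h3
    exact ⟨p, hp, by rwa [← hxn, Equiv.symm_apply_apply]⟩
  obtain ⟨p, -, hp⟩ := key ⟨0, by omega⟩ 0 (by simp [nearStarLegs])
  obtain ⟨q, hq, hq'⟩ := key ⟨1, by omega⟩ 1 (by simp [nearStarLegs])
  have := hq'.eq_leg hp (by omega)
  simp at this

end Recognition

/-! ### Comparing hypertrees by their degrees -/

section Order

variable {k m : ℕ} {T T' : FinHypergraph}

theorem IsUniformHypertree.sum_deg_sub_one (hk : 2 ≤ k) (hm : 1 ≤ m)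
    (hT : IsUniformHypertree k m T) : ∑ v, (T.graph.deg v - 1) + 1 = m := by
  have h1 := hT.sum_deg hk
  have h2 := hT.card_add hk
  have h3 : ∑ v, (T.graph.deg v - 1) + Fintype.card T.V = ∑ v, T.graph.deg v := by
    rw [← Finset.card_univ, Finset.card_eq_sum_ones, ← Finset.sum_add_distrib]
    exact Finset.sum_congr rfl fun v _ => Nat.sub_add_cancel (hT.one_le_deg hk hm v)
  omega

/-- Since `d² = (d-1)² + (d-1) + d` and the two linear sums are fixed by `m` and `k`, degree squares
can be compared through the excesses `d - 1`. -/
theorem IsUniformHypertree.sum_deg_sq (hk : 2 ≤ k) (hm : 1 ≤ m) (hT : IsUniformHypertree k m T) :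
    ∑ v, T.graph.deg v ^ 2 = ∑ v, (T.graph.deg v - 1) ^ 2 + (m - 1) + m * k := by
  have h1 := hT.sum_deg hk
  have h2 := hT.sum_deg_sub_one hk hm
  have h3 : ∑ v, T.graph.deg v ^ 2 =
      ∑ v, (T.graph.deg v - 1) ^ 2 + ∑ v, (T.graph.deg v - 1) + ∑ v, T.graph.deg v := by
    rw [← Finset.sum_add_distrib, ← Finset.sum_add_distrib]
    refine Finset.sum_congr rfl fun v _ => ?_
    obtain ⟨d, hd⟩ : ∃ d, T.graph.deg v = d + 1 :=
      ⟨T.graph.deg v - 1, (Nat.sub_add_cancel (hT.one_le_deg hk hm v)).symm⟩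
    rw [hd, Nat.add_sub_cancel]
    ring
  rw [h3, h1, show ∑ v, (T.graph.deg v - 1) = m - 1 by omega]

theorem IsUniformHypertree.sum_sq_le (hk : 2 ≤ k) (hm : 1 ≤ m) (hT : IsUniformHypertree k m T)
    (b : ℕ) (hb : ∀ v, T.graph.deg v ≤ b + 1) :
    ∑ v, (T.graph.deg v - 1) ^ 2 ≤ b * (m - 1) := by
  have h2 := hT.sum_deg_sub_one hk hm
  calc ∑ v, (T.graph.deg v - 1) ^ 2 ≤ ∑ v, b * (T.graph.deg v - 1) :=
        Finset.sum_le_sum fun v _ => by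
          rw [pow_two]
          exact Nat.mul_le_mul_right _ (by have := hb v; omega)
    _ = b * (m - 1) := by rw [← Finset.mul_sum]; congr 1; omega

theorem IsUniformHypertree.le_sum_sq (hk : 2 ≤ k) (hm : 1 ≤ m) (hT : IsUniformHypertree k m T)
    (v : T.V) (b : ℕ) (hb : b + 1 ≤ T.graph.deg v) :
    b ^ 2 + (m - 1 - b) ≤ ∑ v, (T.graph.deg v - 1) ^ 2 := by
  have h2 := hT.sum_deg_sub_one hk hm
  rw [← Finset.add_sum_erase _ _ (Finset.mem_univ v)] at h2 ⊢
  have h3 : ∑ x ∈ Finset.univ.erase v, (T.graph.deg x - 1) ≤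
      ∑ x ∈ Finset.univ.erase v, (T.graph.deg x - 1) ^ 2 :=
    Finset.sum_le_sum fun x _ => Nat.le_self_pow two_ne_zero _
  obtain ⟨c, hc⟩ : ∃ c, T.graph.deg v - 1 = b + c := ⟨T.graph.deg v - 1 - b, by omega⟩
  rw [hc] at h2 ⊢
  -- Any excess `c` of `v` beyond `b` also contributes at least `c` to the sum of squares, like the
  -- excesses of the other vertices.
  have h4 : b ^ 2 + c ≤ (b + c) ^ 2 := by nlinarith [Nat.le_self_pow two_ne_zero c, Nat.zero_le (b * c)]
  omega

theorem sPrec_of_sum_sq_lt (hk : 2 ≤ k) (hm : 3 ≤ m) {a : ℝ} (ha : 0 < a)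
    (hT : IsUniformHypertree k m T) (hT' : IsUniformHypertree k m T')
    (h : ∑ v, (T.graph.deg v - 1) ^ 2 < ∑ v, (T'.graph.deg v - 1) ^ 2) : SPrec k a T T' := by
  have hcard : Fintype.card T.V = Fintype.card T'.V := by
    have := hT.card_add hk
    have := hT'.card_add hk
    omega
  have hdeg : ∑ v, (T.graph.deg v : ℝ) = ∑ v, (T'.graph.deg v : ℝ) := by
    exact_mod_cast (hT.sum_deg hk).trans (hT'.sum_deg hk).symm
  -- This keeps order 2 within the range `n(k-1)^(n-1) - 1` of the comparison.
  have hn : 4 ≤ Fintype.card T.V := by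
    have := hT.card_add hk
    nlinarith
  refine ⟨hcard, 2, one_le_two, ?_, ?_, ?_⟩
  · have : 1 ≤ (k - 1) ^ (Fintype.card T.V - 1) := Nat.one_le_pow _ _ (by omega)
    have := Nat.mul_le_mul hn this
    omega
  · intro t ht
    interval_cases t
    · rw [moment, moment, Hypergraph.alphaTensor_trace_zero, Hypergraph.alphaTensor_trace_zero,
        hcard]
    · rw [moment, moment, Hypergraph.alphaTensor_trace_one hk hT.1,
        Hypergraph.alphaTensor_trace_one hk hT'.1, hcard, hdeg]
  · rw [moment, moment, Hypergraph.alphaTensor_trace_two hk hT.1,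
      Hypergraph.alphaTensor_trace_two hk hT'.1, hcard, hdeg]
    have hlt : ∑ v, T.graph.deg v ^ 2 < ∑ v, T'.graph.deg v ^ 2 := by
      have h1 := hT.sum_deg_sq hk (by omega)
      have h2 := hT'.sum_deg_sq hk (by omega)
      omega
    have hlt' : ∑ v, (T.graph.deg v : ℝ) ^ 2 < ∑ v, (T'.graph.deg v : ℝ) ^ 2 := by
      exact_mod_cast hlt
    have hpos : (0 : ℝ) < ((k - 1 : ℕ) : ℝ) ^ (Fintype.card T'.V - 1) :=
      pow_pos (by exact_mod_cast (by omega : 0 < k - 1)) _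
    gcongr

theorem star_isUniformHypertree (hk : 2 ≤ k) (m : ℕ) :
    IsUniformHypertree k m (starlike k fun _ : Fin m => 1) := by
  have := starlike_isUniformHypertree (ℓ := fun _ : Fin m => 1) hk fun _ => by omega
  simpa using this

theorem nearStar_isUniformHypertree (hk : 2 ≤ k) (hm : 3 ≤ m) :
    IsUniformHypertree k m (starlike k (nearStarLegs m)) := by
  have := starlike_isUniformHypertree (ℓ := nearStarLegs m) hk fun i => by
    simp only [nearStarLegs]
    split_ifs <;> omega
  rwa [sum_nearStarLegs hm] at this

theorem star_isLast (hk : 2 ≤ k) (hm : 3 ≤ m) {a : ℝ} (ha : 0 < a) :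
    IsLast k a (IsUniformHypertree k m) (starlike k fun _ : Fin m => 1) := by
  have hL := star_isUniformHypertree hk m
  refine ⟨hL, fun T hT hiso => sPrec_of_sum_sq_lt hk hm ha hT hL ?_⟩
  -- Without a vertex of degree `m` every excess is at most `m - 2`, and `(m-2)(m-1) < (m-1)²`.
  have h1 := hT.sum_sq_le hk (by omega) (m - 2) fun v => by
    have := hT.deg_le v
    have : T.graph.deg v ≠ m := fun h => hiso (iso_starlike_of_deg_eq hk (by omega) hT v h)
    omega
  have h2 := hL.le_sum_sq hk (by omega) none (m - 1) (by
    have := le_deg_starlike_center (ℓ := fun _ : Fin m => 1) hk fun _ => le_rfl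
    omega)
  obtain ⟨n, rfl⟩ : ∃ n, m = n + 3 := ⟨m - 3, by omega⟩
  refine h1.trans_lt (lt_of_lt_of_le ?_ h2)
  simp only [show n + 3 - 2 = n + 1 from rfl, show n + 3 - 1 = n + 2 from rfl]
  nlinarith

theorem nearStar_isLast (hk : 2 ≤ k) (hm : 3 ≤ m) {a : ℝ} (ha : 0 < a) :
    IsLast k a (fun T => IsUniformHypertree k m T ∧ ¬ Iso T (starlike k fun _ : Fin m => 1))
      (starlike k (nearStarLegs m)) := by
  have hS := nearStar_isUniformHypertree hk hm
  refine ⟨⟨hS, not_iso_nearStar_star hk hm⟩, fun T ⟨hT, hiso⟩ hiso' =>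
    sPrec_of_sum_sq_lt hk hm ha hT hS ?_⟩
  -- With degrees `m` and `m - 1` excluded every excess is at most `m - 3`, and `(m-3)(m-1) = (m-2)²
  -- - 1 < (m-2)² + 1`.
  have h1 := hT.sum_sq_le hk (by omega) (m - 3) fun v => by
    have := hT.deg_le v
    have : T.graph.deg v ≠ m := fun h => hiso (iso_starlike_of_deg_eq hk (by omega) hT v h)
    have : T.graph.deg v + 1 ≠ m := fun h => hiso' (iso_nearStar_of_deg_add_one_eq hk hm hT v h)
    omega
  have h2 := hS.le_sum_sq hk (by omega) none (m - 2) (by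
    have := le_deg_starlike_center (ℓ := nearStarLegs m) hk fun i => by
      simp only [nearStarLegs]
      split_ifs <;> omega
    omega)
  obtain ⟨n, rfl⟩ : ∃ n, m = n + 3 := ⟨m - 3, by omega⟩
  refine h1.trans_lt (lt_of_lt_of_le ?_ h2)
  simp only [Nat.add_sub_cancel, show n + 3 - 2 = n + 1 from rfl, show n + 3 - 1 = n + 2 from rfl,
    show n + 2 - (n + 1) = 1 by omega]
  nlinarith

end Order

end FinHypergraph

theorem mainTheorem7 (k m : ℕ) (hk : 2 ≤ k) (hm : 3 ≤ m) (a : ℝ) (ha0 : 0 < a) (ha1 : a < 1) :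
    FinHypergraph.IsSecondLast k a (FinHypergraph.IsUniformHypertree k m)
      (FinHypergraph.starlike k
        (fun i : Fin (m - 1) => if i.val = 1 then 2 else 1)) :=
  ⟨_, FinHypergraph.star_isLast hk hm ha0, FinHypergraph.nearStar_isLast hk hm ha0⟩
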